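/- **Setting.** Let $V$ be a set of $n\ge 1$ observed variables. Each of $M$ entities $i\in[M]$ has its own causal DAG $\mathcal D_i$ over $V\cup L_i$ ($L_i$ finite, latent); its interventional distributions $\mathrm{do}(w)$, $w\in V$, satisfy the causal Markov condition and faithfulness: a conditional independence between two observed variables given observed variables holds under $\mathrm{do}(w)$ iff the corresponding d-separation holds in $\mathcal D_i$ with all edges into $w$ removed. Let $\mathcal M_i$ be the maximal ancestral graph (MAG) over $V$ of $\mathcal D_i$ ($u,v$ adjacent iff $\mathcal D_i$ has an inducing path between them relative to $L_i$; $u\to v$ if $u$ is an ancestor of $v$ in $\mathcal D_i$, $u\leftarrow v$ if $v$ is an ancestor of $u$, $u\leftrightarrow v$ otherwise), and $\mathcal U_i$ its partial ancestral graph (PAG): the graph with the adjacencies of $\mathcal M_i$ whose edge ends are marked by an arrowhead (tail) if all MAGs Markov equivalent to $\mathcal M_i$ have an arrowhead (tail) there, and by a circle otherwise. Let $N_i(u)$ be the set of pairs (neighbour $v$ of $u$ in $\mathcal M_i$, type $\to,\leftarrow,\leftrightarrow$ of the edge $uv$), and $d(\mathcal M_i,\mathcal M_j)=|\{u: N_i(u)\ne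 N_j(u)\}|$. The MAGs satisfy $\alpha$-clustering ($\alpha>0$) with true clusters $C_1^\star,\dots,C_k^\star$ (a partition of $[M]$ into nonempty sets) if $d(\mathcal M_i,\mathcal M_j)=0$ for $i,j$ in the same cluster and $d(\mathcal M_i,\mathcal M_j)\ge\alpha n$ for $i,j$ in different clusters. **Algorithm $\alpha$-General** (input: $\alpha$, $\delta$, the PAGs; access to entity $i$ only through conditional independence tests in the distributions of atomic interventions that it has performed in $i$). Let $D_i(u)$ be the set of neighbours of $u$ in $\mathcal U_i$. $\mathrm{Out}_i(u)$ is computed as the set of $v$ with $u\to v$ in $\mathcal U_i$, or with $u\circ\!\!-\!\!\circ v$ or $u\circ\!\!\to v$ in $\mathcal U_i$ and $u\not\perp v\mid\mathrm{do}(u)$. $\mathrm{Bi}_i(u)$ is computed as the set of $v$ with $u\leftrightarrow v$ in $\mathcal U_i$, or with $u\circ\!\!-\!\!\circ v$, $u\leftarrow\!\!\circ v$ or $u\circ\!\!\to v$ in $\mathcal U_i$ and $u\perp v\mid\mathrm{do}(u)$, $u\perp v\mid\mathrm{do}(v)$. 1. Sample a list $S$ of $\lceil 2\log(2M/\delta)/\alpha\rceil$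 nodes of $V$ uniformly with replacement and intervene on each of them in every entity. Let $\mathcal P$ be the graph on $[M]$ joining $i\neq j$ iff $\mathrm{Out}_i(u)=\mathrm{Out}_j(u)$ and $D_i(u)=D_j(u)$ for all $u\in S$. 2. Repeat rounds: choose fresh independent uniform nodes $\pi(i)\in V$ and intervene on $\pi(i)$ in entity $i$, for all $i\in[M]$. If there are an edge $(i,j)$ of $\mathcal P$ with $\pi(i)=\pi(j)=:v$ and a $u\in S$ such that $v$ is in exactly one of $\mathrm{Bi}_i(u),\mathrm{Bi}_j(u)$, select one such triple $(i,j,u)$ by an arbitrary fixed rule, intervene on $v$ in every entity of the component $T$ of $i$ in $\mathcal P$, and remove from $\mathcal P$ all edges $(i',j')$ with $i',j'\in T$ such that $v$ is in exactly one of $\mathrm{Bi}_{i'}(u),\mathrm{Bi}_{j'}(u)$. Stop after the first round that removes no edge and return the connected components of $\mathcal P$. **Lemma.** There are absolute constants $c,K>0$ such that the following holds for all $n\ge1$, all $M$, all entities as above, all $\alpha>0$ and $0<\delta<1$ with $M\ge 2$ or $\delta\le\frac12$, and every selection rule. If the MAGs $\mathcal M_1,\dots,\mathcal M_M$ satisfy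 $\alpha$-clustering with true clusters $C_1^\star,\dots,C_k^\star$ and $|C_b^\star|\ge c\,n\log(M/\delta)$ for every $b$, then: 1. with probability at least $1-\delta$, Algorithm $\alpha$-General returns exactly $\{C_1^\star,\dots,C_k^\star\}$; 2. for every outcome of the random choices, at most $K\left(\log(M/\delta)/\alpha+k^2\right)$ atomic interventions (counted with repetitions) are made in every entity; 3. in every round, started from any subgraph $\mathcal P$ of the initial graph of a sample $S$ and after any set of interventions that includes those of step 1, and for any $\pi$: either no edge $(i,j)$ of $\mathcal P$ with $\pi(i)=\pi(j)=v$ and no $u\in S$ exist such that the edge between $u$ and $v$ is $u\leftrightarrow v$ in one of $\mathcal M_i,\mathcal M_j$ and $u\leftarrow v$ in the other, and $\mathcal P$ is unchanged; or, for some such $i$, $j$, $u$, $v$, the round removes from $\mathcal P$ exactly the edges $(i',j')$ in the component of $i$ for which one of $\mathcal M_{i'},\mathcal M_{j'}$ has $u\leftrightarrow v$ and the other has $u\leftarrow v$. -/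

import Mathlib

open MeasureTheory ProbabilityTheory

/-! ### Mixed graphs, separation, maximal ancestral graphs -/

/-- A mixed graph with directed edges `dir u v` (`u → v`) and bidirected edges `bi u v` (`u ↔ v`),
with at most one edge between two nodes and no loops. -/
structure MixedGraph (W : Type*) where
  dir : W → W → Prop
  bi : W → W → Prop
  dir_asymm : ∀ u v, dir u v → ¬ dir v u
  bi_symm : ∀ u v, bi u v → bi v u
  bi_irrefl : ∀ u, ¬ bi u u
  dir_not_bi : ∀ u v, dir u v → ¬ bi u v

namespace MixedGraph

variable {W : Type*} (G : MixedGraph W)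

/-- There is an edge between `u` and `v` with an arrowhead at `v`. -/
def Into (u v : W) : Prop := G.dir u v ∨ G.bi u v

def Adj (u v : W) : Prop := G.dir u v ∨ G.dir v u ∨ G.bi u v

/-- `u` is an ancestor of `v`: `u = v` or there is a directed path from `u` to `v`. -/
def Anc (u v : W) : Prop := Relation.ReflTransGen G.dir u v

/-- `l` is the list of nodes of a path (no repeated nodes) from `u` to `v`. -/
structure IsPath (u v : W) (l : List W) : Prop where
  head : l.head? = some u
  last : l.getLast? = some v
  chain : l.IsChain G.Adj
  nodup : l.Nodup

/-- For consecutive nodes `a, w, b` of a path: `w` is a collider. -/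
def Collider (a w b : W) : Prop := G.Into a w ∧ G.Into b w

/-- `l` is an inducing path between `u` and `v` relative to `S`: every interior node outside `S` is
a collider, and every collider is an ancestor of an endpoint. -/
structure IsInducingPath (S : Set W) (u v : W) (l : List W) : Prop where
  path : G.IsPath u v l
  collider : ∀ a w b, [a, w, b] <:+: l → w ∉ S → G.Collider a w b
  anc : ∀ a w b, [a, w, b] <:+: l → G.Collider a w b → G.Anc w u ∨ G.Anc w v

/-- `l` is an m-connecting path between `u` and `v` relative to `Z`. -/
structure IsMConnecting (Z : Set W) (u v : W) (l : List W) : Prop where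
  path : G.IsPath u v l
  noncollider : ∀ a w b, [a, w, b] <:+: l → ¬ G.Collider a w b → w ∉ Z
  collider : ∀ a w b, [a, w, b] <:+: l → G.Collider a w b → ∃ z ∈ Z, G.Anc w z

/-- `u` and `v` are m-separated by `Z` (d-separated, if `G` has only directed edges). -/
def MSep (u v : W) (Z : Set W) : Prop := ¬ ∃ l, G.IsMConnecting Z u v l

/-- Ancestral: no directed cycles, and no directed path between the ends of a bidirected edge. -/
def IsAncestral : Prop :=
  (∀ u v, G.dir u v → ¬ G.Anc v u) ∧ (∀ u v, G.bi u v → ¬ G.Anc u v ∧ ¬ G.Anc v u)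

/-- Maximal ancestral graph: ancestral, and no inducing path (relative to `∅`) between two
distinct non-adjacent nodes. -/
def IsMAG : Prop :=
  G.IsAncestral ∧ ∀ u v, u ≠ v → ¬ G.Adj u v → ¬ ∃ l, G.IsInducingPath ∅ u v l

/-- Markov equivalence: the same m-separations hold. -/
def MarkovEquiv (G H : MixedGraph W) : Prop :=
  ∀ u v (Z : Set W), u ≠ v → u ∉ Z → v ∉ Z → (G.MSep u v Z ↔ H.MSep u v Z)

/-- The Markov equivalence class `[G]`: all MAGs that are Markov equivalent to `G`. -/
def markovClass : Set (MixedGraph W) := {H | H.IsMAG ∧ MarkovEquiv G H}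

/-- The type of an edge as seen from one of its endpoints `u`: `u → v`, `u ← v`, `u ↔ v`. -/
inductive IncidenceType
  | tail
  | head
  | bidirected

/-- The incidence set `N(u)`. -/
def incidence (u : W) : Set (W × IncidenceType) :=
  {p | (p.2 = .tail ∧ G.dir u p.1) ∨ (p.2 = .head ∧ G.dir p.1 u) ∨
    (p.2 = .bidirected ∧ G.bi u p.1)}

/-- The node-distance: the number of nodes with different incidence sets. -/
noncomputable def nodeDist (G H : MixedGraph W) : ℕ :=
  {u | G.incidence u ≠ H.incidence u}.ncard

/-- The edge between `u` and `v` is `u ↔ v` in one of the two graphs and `u ← v` in the other. -/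
def BidirectedVsDirected (G H : MixedGraph W) (u v : W) : Prop :=
  (G.bi u v ∧ H.dir v u) ∨ (G.dir v u ∧ H.bi u v)

theorem adj_symm {u v : W} (h : G.Adj u v) : G.Adj v u := by
  rcases h with h | h | h
  · exact Or.inr (Or.inl h)
  · exact Or.inl h
  · exact Or.inr (Or.inr (G.bi_symm _ _ h))

theorem IsInducingPath.symm {S : Set W} {u v : W} {l : List W}
    (h : G.IsInducingPath S u v l) : G.IsInducingPath S v u l.reverse := by
  have inf : ∀ a w b, [a, w, b] <:+: l.reverse → [b, w, a] <:+: l := by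
    intro a w b hi
    have := List.reverse_infix.mpr hi
    simpa using this
  refine ⟨⟨?_, ?_, ?_, ?_⟩, ?_, ?_⟩
  · rw [List.head?_reverse]; exact h.path.last
  · rw [List.getLast?_reverse]; exact h.path.head
  · rw [List.isChain_reverse]
    exact h.path.chain.imp fun a b hab => G.adj_symm hab
  · exact List.nodup_reverse.mpr h.path.nodup
  · intro a w b hi hw
    exact (h.collider b w a (inf a w b hi) hw).symm
  · intro a w b hi hc
    exact (h.anc b w a (inf a w b hi) hc.symm).symm

end MixedGraph

/-! ### Causal DAGs, interventions, and the MAG of a DAG -/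

/-- A directed acyclic graph. -/
structure CausalDAG (W : Type*) where
  edge : W → W → Prop
  acyclic : ∀ x, ¬ Relation.TransGen edge x x

namespace CausalDAG

variable {W : Type*}

/-- A DAG as a mixed graph without bidirected edges. -/
def toMixed (D : CausalDAG W) : MixedGraph W where
  dir := D.edge
  bi := fun _ _ => False
  dir_asymm := fun u _ huv hvu =>
    D.acyclic u (Relation.TransGen.trans (.single huv) (.single hvu))
  bi_symm := fun _ _ h => h
  bi_irrefl := fun _ h => h
  dir_not_bi := fun _ _ _ h => h

/-- The mutilated graph of the intervention `do(w)`: all edges into `w` are removed. -/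
def mutilate (D : CausalDAG W) (w : W) : CausalDAG W where
  edge := fun x y => D.edge x y ∧ y ≠ w
  acyclic := fun x h => D.acyclic x (Relation.TransGen.mono (fun _ _ hab => hab.1) _ _ h)

variable {V L : Type*}

/-- Two observed nodes are adjacent in the MAG of `D` if and only if they are joined by an inducing
path relative to the latent nodes in `D`. -/
def MagAdj (D : CausalDAG (V ⊕ L)) (u v : V) : Prop :=
  u ≠ v ∧ ∃ l, D.toMixed.IsInducingPath (Set.range Sum.inr) (Sum.inl u) (Sum.inl v) l

theorem MagAdj.symm {D : CausalDAG (V ⊕ L)} {u v : V} (h : D.MagAdj u v) : D.MagAdj v u := by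
  obtain ⟨hne, l, hl⟩ := h
  exact ⟨hne.symm, l.reverse, hl.symm⟩

theorem anc_antisymm (D : CausalDAG W) {x y : W} (hxy : D.toMixed.Anc x y)
    (hyx : D.toMixed.Anc y x) : x = y := by
  rcases Relation.reflTransGen_iff_eq_or_transGen.mp hxy with h | h
  · exact h.symm
  · exact absurd (h.trans_left hyx) (D.acyclic x)

/-- The MAG over the observed nodes `V` of a DAG over `V` and the latent nodes `L`. -/
def mag (D : CausalDAG (V ⊕ L)) : MixedGraph V where
  dir := fun u v => D.MagAdj u v ∧ D.toMixed.Anc (Sum.inl u) (Sum.inl v)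
  bi := fun u v => D.MagAdj u v ∧ ¬ D.toMixed.Anc (Sum.inl u) (Sum.inl v) ∧
    ¬ D.toMixed.Anc (Sum.inl v) (Sum.inl u)
  dir_asymm := fun _ _ huv hvu =>
    huv.1.1 (Sum.inl_injective (D.anc_antisymm huv.2 hvu.2))
  bi_symm := fun _ _ h => ⟨h.1.symm, h.2.2, h.2.1⟩
  bi_irrefl := fun _ h => h.1.1 rfl
  dir_not_bi := fun _ _ h h' => h'.2.1 h.2

end CausalDAG

/-! ### Entities, conditional independence tests -/

/-- The conditional independence test "`u` is independent of `v` given `Z`" in a joint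
distribution `μ` of the observed variables. -/
def CITest {V : Type*} [Fintype V] (μ : ProbabilityMeasure (V → ℝ)) (u v : V)
    (Z : Finset V) : Prop :=
  CondIndepFun (MeasurableSpace.comap (fun (x : V → ℝ) (z : Z) => x z) inferInstance)
    (Measurable.comap_le (measurable_pi_lambda _ fun z => measurable_pi_apply (z : V)))
    (fun x => x u) (fun x => x v) (μ : Measure (V → ℝ))

/-- An entity: a causal DAG over the observed variables `V` and finitely many latent variables of
its own, and for every `w : V` the joint distribution of the observed variables under the
(randomized) atomic intervention `do(w)`. -/
structure Entity (V : Type*) where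
  Latent : Type
  latent_finite : Finite Latent
  dag : CausalDAG (V ⊕ Latent)
  doLaw : V → ProbabilityMeasure (V → ℝ)

namespace Entity

variable {V : Type*}

def mag (E : Entity V) : MixedGraph V := E.dag.mag

/-- Causal Markov condition and faithfulness of the interventional distributions: a conditional
independence among observed variables holds under `do(w)` if and only if the corresponding
d-separation holds in the mutilated DAG. -/
def MarkovFaithful [Fintype V] (E : Entity V) : Prop :=
  ∀ (w u v : V) (Z : Finset V), u ≠ v → u ∉ Z → v ∉ Z →
    (CITest (E.doLaw w) u v Z ↔
      (E.dag.mutilate (Sum.inl w)).toMixed.MSep (Sum.inl u) (Sum.inl v) (Sum.inl '' (Z : Set V)))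

end Entity

/-- The partition `C` of the entities witnesses the `(α, β)`-clustering property. -/
def IsClustering {V : Type*} [Fintype V] {M : ℕ} (G : Fin M → MixedGraph V) (α β : ℝ)
    (C : Finpartition (Finset.univ : Finset (Fin M))) : Prop :=
  0 ≤ β ∧ β < α ∧
  (∀ A ∈ C.parts, ∀ i ∈ A, ∀ j ∈ A,
    ((G i).nodeDist (G j) : ℝ) ≤ β * (Fintype.card V : ℝ)) ∧
  (∀ A ∈ C.parts, ∀ B ∈ C.parts, A ≠ B → ∀ i ∈ A, ∀ j ∈ B,
    α * (Fintype.card V : ℝ) ≤ ((G i).nodeDist (G j) : ℝ))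

/-- The `α`-clustering property. -/
def IsAlphaClustering {V : Type*} [Fintype V] {M : ℕ} (G : Fin M → MixedGraph V) (α : ℝ)
    (C : Finpartition (Finset.univ : Finset (Fin M))) : Prop :=
  IsClustering G α 0 C

/-! ### Partial ancestral graphs -/

inductive EndMark
  | arrow
  | tail
  | circle

/-- A graph whose edges carry one of three marks at each end. `mark u v` is the mark at `v` of the
edge between `u` and `v`; it has a meaning only if `u` and `v` are adjacent. -/
structure PAG (V : Type*) where
  adj : V → V → Prop
  mark : V → V → EndMark

namespace PAG

variable {V : Type*} (U : PAG V)

/-- `u → v` -/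
def Directed (u v : V) : Prop := U.adj u v ∧ U.mark v u = .tail ∧ U.mark u v = .arrow

/-- `u ↔ v` -/
def Bidirected (u v : V) : Prop := U.adj u v ∧ U.mark v u = .arrow ∧ U.mark u v = .arrow

/-- `u o-o v` -/
def CircleCircle (u v : V) : Prop := U.adj u v ∧ U.mark v u = .circle ∧ U.mark u v = .circle

/-- `u o→ v` -/
def CircleArrow (u v : V) : Prop := U.adj u v ∧ U.mark v u = .circle ∧ U.mark u v = .arrow

/-- The nodes adjacent to `u`. -/
def nbrs (u : V) : Set V := {v | U.adj u v}

end PAG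

open Classical in
/-- The PAG of (the Markov equivalence class of) a MAG `G`: it has the adjacencies of `G`; a mark
is an arrowhead (a tail) if it is an arrowhead (a tail) in every member of the class, and a circle
otherwise. -/
noncomputable def MixedGraph.pag {V : Type*} (G : MixedGraph V) : PAG V where
  adj := G.Adj
  mark := fun u v =>
    if ∀ H ∈ G.markovClass, H.Into u v then .arrow
    else if ∀ H ∈ G.markovClass, H.dir v u then .tail
    else .circle

/-! ### The algorithm

The algorithm sees an entity only through its PAG and through the interventional distributions
of the nodes on which it has intervened in this entity. `log i` is the list of all atomic
interventions that have been made in entity `i` (repetitions count). -/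

namespace AlphaGeneral

variable {V : Type*}

/-- What is known about one entity: the distributions of the interventions made so far. -/
abbrev Data (V : Type*) := V → Option (ProbabilityMeasure (V → ℝ))

open Classical in
noncomputable def observe (law : V → ProbabilityMeasure (V → ℝ)) (log : List V) : Data V :=
  fun w => if w ∈ log then some (law w) else none

/-- The test of `u` against `v` in the available distribution of `do(w)` shows independence. -/
def TestIndep [Fintype V] (data : Data V) (w u v : V) : Prop :=
  ∃ μ, data w = some μ ∧ CITest μ u v ∅

/-- The test of `u` against `v` in the available distribution of `do(w)` shows dependence. -/
def TestDep [Fintype V] (data : Data V) (w u v : V) : Prop :=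
  ∃ μ, data w = some μ ∧ ¬ CITest μ u v ∅

def identifyOutNbr [Fintype V] (U : PAG V) (data : Data V) (u : V) : Set V :=
  {v | U.Directed u v} ∪
    {v | (U.CircleCircle u v ∨ U.CircleArrow u v) ∧ TestDep data u u v}

def identifyBidirected [Fintype V] (U : PAG V) (data : Data V) (u : V) : Set V :=
  {v | U.Bidirected u v} ∪
    {v | (U.CircleCircle u v ∨ U.CircleArrow v u ∨ U.CircleArrow u v) ∧
      TestIndep data u u v ∧ TestIndep data v u v}

/-- The number of sampled nodes. -/
noncomputable def sampleSize (M : ℕ) (α δ : ℝ) : ℕ := ⌈2 * Real.log (2 * M / δ) / α⌉₊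

variable [Fintype V] {M s : ℕ}
  (U : Fin M → PAG V) (law : Fin M → V → ProbabilityMeasure (V → ℝ))

/-- The initial log: every entity is intervened on at every sampled node. -/
def initialLog (S : Fin s → V) : Fin M → List V := fun _ => List.ofFn S

/-- The initial graph on the entities: `i` and `j` are joined if they have the same outgoing
neighbours and the same adjacent nodes at every sampled node. -/
def initialGraph (S : Fin s → V) : SimpleGraph (Fin M) where
  Adj i j := i ≠ j ∧ ∀ a,
    identifyOutNbr (U i) (observe (law i) (initialLog (M := M) S i)) (S a) =
      identifyOutNbr (U j) (observe (law j) (initialLog (M := M) S j)) (S a) ∧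
    (U i).nbrs (S a) = (U j).nbrs (S a)
  symm := ⟨fun _ _ h => ⟨h.1.symm, fun a => ⟨(h.2 a).1.symm, (h.2 a).2.symm⟩⟩⟩
  loopless := ⟨fun _ h => h.1 rfl⟩

/-- With the interventions in `log`, exactly one of `i`, `j` is found to have the bidirected edge
between `u` and `v`. -/
def Differ (log : Fin M → List V) (u v : V) (i j : Fin M) : Prop :=
  Xor (v ∈ identifyBidirected (U i) (observe (law i) (log i)) u)
    (v ∈ identifyBidirected (U j) (observe (law j) (log j)) u)

open Classical in
/-- All `(i, j, u)` with an edge between `i` and `j` in `P`, `π i = π j =: v`, and a sampled node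
`u` such that `i` and `j` are found to differ at the bidirected edge between `u` and `v`. -/
noncomputable def candidates (S : Fin s → V) (P : SimpleGraph (Fin M)) (log : Fin M → List V)
    (π : Fin M → V) : Finset (Fin M × Fin M × V) :=
  {x | P.Adj x.1 x.2.1 ∧ π x.1 = π x.2.1 ∧ x.2.2 ∈ Set.range S ∧
    Differ U law log x.2.2 (π x.1) x.1 x.2.1}

/-- Remove from `P` the edges inside the component of `i₀` between entities found to differ at the
bidirected edge between `u` and `v`. -/
def removeEdges (P : SimpleGraph (Fin M)) (log : Fin M → List V) (i₀ : Fin M) (u v : V) :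
    SimpleGraph (Fin M) where
  Adj i j := P.Adj i j ∧
    ¬ (P.Reachable i₀ i ∧ P.Reachable i₀ j ∧ Differ U law log u v i j)
  symm := ⟨fun _ _ h =>
    ⟨h.1.symm, fun h' => h.2 ⟨h'.2.1, h'.1, (xor_comm _ _).mp h'.2.2⟩⟩⟩
  loopless := ⟨fun i h => P.loopless.irrefl i h.1⟩

open Classical in
/-- One round of the refinement with random assignment `π`: intervene on `π i` in every entity `i`;
if some candidate `(i, j, u)` exists, select one by the rule `pick`, intervene on `v = π i` in every
entity of the component of `i`, and remove the edges of this component between entities that are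
found to differ at the bidirected edge between `u` and `v`. -/
noncomputable def refine (pick : Finset (Fin M × Fin M × V) → Fin M × Fin M × V)
    (S : Fin s → V) (P : SimpleGraph (Fin M)) (log : Fin M → List V) (π : Fin M → V) :
    SimpleGraph (Fin M) × (Fin M → List V) :=
  let log₁ : Fin M → List V := fun i => π i :: log i
  let cand := candidates U law S P log₁ π
  if cand.Nonempty then
    let i₀ := (pick cand).1
    let u := (pick cand).2.2
    let v := π i₀
    let log₂ : Fin M → List V := fun i => if P.Reachable i₀ i then v :: log₁ i else log₁ i
    (removeEdges U law P log₂ i₀ u v, log₂)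
  else (P, log₁)

theorem refine_le (pick : Finset (Fin M × Fin M × V) → Fin M × Fin M × V)
    (S : Fin s → V) (P : SimpleGraph (Fin M)) (log : Fin M → List V) (π : Fin M → V) :
    (refine U law pick S P log π).1 ≤ P := by
  unfold refine
  dsimp only
  split_ifs
  · intro i j h
    exact h.1
  · exact le_rfl

/-- The outcome of a run: the returned partition of the entities and the interventions made. -/
structure Result (V : Type*) (M : ℕ) where
  clusters : Set (Set (Fin M))
  log : Fin M → List V

/-- The vertex sets of the connected components. -/
def components (P : SimpleGraph (Fin M)) : Set (Set (Fin M)) :=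
  Set.range (SimpleGraph.ConnectedComponent.supp : P.ConnectedComponent → Set (Fin M))

open Classical in
/-- The main loop: rounds with fresh uniform assignments `π`, until a round changes nothing. -/
noncomputable def loop [Nonempty V] (pick : Finset (Fin M × Fin M × V) → Fin M × Fin M × V)
    (S : Fin s → V) (P : SimpleGraph (Fin M)) (log : Fin M → List V) : PMF (Result V M) :=
  (PMF.uniformOfFintype (Fin M → V)).bind fun π =>
    if h : (refine U law pick S P log π).1 = P then
      PMF.pure ⟨components (refine U law pick S P log π).1, (refine U law pick S P log π).2⟩
    else
      loop pick S (refine U law pick S P log π).1 (refine U law pick S P log π).2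
termination_by P.edgeSet.ncard
decreasing_by
  exact Set.ncard_lt_ncard (SimpleGraph.edgeSet_ssubset_edgeSet.mpr
    (lt_of_le_of_ne (refine_le U law pick S P log π) h))

open Classical in
/-- The algorithm: sample nodes uniformly with replacement, build the initial graph on the
entities, and refine it. The result is the distribution of the outcome. -/
noncomputable def run [Nonempty V] (pick : Finset (Fin M × Fin M × V) → Fin M × Fin M × V)
    (α δ : ℝ) : PMF (Result V M) :=
  (PMF.uniformOfFintype (Fin (sampleSize M α δ) → V)).bind fun S =>
    loop U law pick S (initialGraph U law S) (initialLog S)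

end AlphaGeneral

/-! Since `do(u)` deletes the edges into `u`, the marginal test of `u` against `v` under `do(u)`
decides whether `u` is an ancestor of `v` (`mutilate_mSep_empty_iff`). The MAG of a DAG really is a
MAG (`mag_isMAG`), so it belongs to its own Markov class and every arrowhead or tail of the PAG is
true of it. The ancestry tests resolve the circles: the computed children are exact once `u` has
been intervened on, the computed bidirected edges once both ends have been. On an edge of the entity
graph, children and neighbours agree at every sampled node, so the only disagreement left there is
`↔` against `←`. This determines the effect of a round (`refine_spec`).

Entities with equal MAGs are never separated, so a run can only fail by stopping while two clusters
are still joined. Outside a rare event the sample contains, for each two distinct MAGs, a node where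
they differ. Then any edge across clusters yields a node `v` at which a test would reveal a
difference. Adjacency depends only on the MAGs, so the round makes progress as soon as some entity
of each of the two clusters draws `v`. A union bound over at most `M ^ 2` rounds finishes
(`toOuterMeasure_loop_compl_le`).

For the cost, each productive round removes at least one ordered pair of MAGs from the joined ones
(`joinedPairs_refine_ssubset`). There are at most `k ^ 2` such pairs, and a round costs an entity at
most two interventions. -/

/-! ### Consecutive triples in lists, and reversal of connecting paths -/

/-- Collider conditions concern consecutive triples; gluing at `x` creates no new triple except the
one centred at `x`. -/
theorem List.triple_infix_append_cons {α : Type*} {p w q x : α} {l₁ l₂ : List α}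
    (h : [p, w, q] <:+: l₁ ++ x :: l₂) :
    [p, w, q] <:+: l₁ ++ [x] ∨ [p, w, q] <:+: x :: l₂ ∨
      (w = x ∧ (∃ s, l₁ = s ++ [p]) ∧ ∃ t, l₂ = q :: t) := by
  induction l₁ with
  | nil => exact Or.inr (Or.inl h)
  | cons y l₁ ih =>
    rw [List.cons_append, List.infix_cons_iff] at h
    rcases h with h | h
    · match l₁, h with
      | [], h =>
        obtain ⟨t, ht⟩ := h
        simp only [List.cons_append, List.nil_append, List.cons.injEq] at ht
        obtain ⟨rfl, rfl, rfl⟩ := ht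
        exact Or.inr (Or.inr ⟨rfl, ⟨[], rfl⟩, _, rfl⟩)
      | [z], h =>
        obtain ⟨t, ht⟩ := h
        simp only [List.cons_append, List.nil_append, List.cons.injEq] at ht
        obtain ⟨rfl, rfl, rfl, -⟩ := ht
        exact Or.inl (List.infix_refl _)
      | z :: z' :: l, h =>
        obtain ⟨t, ht⟩ := h
        simp only [List.cons_append, List.nil_append, List.cons.injEq] at ht
        obtain ⟨rfl, rfl, rfl, -⟩ := ht
        exact Or.inl ⟨[], l ++ [x], rfl⟩
    · rcases ih h with h | h | ⟨h, ⟨s, hs⟩, ht⟩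
      · exact Or.inl (List.infix_cons h)
      · exact Or.inr (Or.inl h)
      · exact Or.inr (Or.inr ⟨h, ⟨y :: s, by rw [hs, List.cons_append]⟩, ht⟩)

theorem List.exists_split_of_not_nodup {α : Type*} {l : List α} (h : ¬ l.Nodup) :
    ∃ l₁ x l₂ l₃, l = l₁ ++ x :: (l₂ ++ x :: l₃) := by
  obtain ⟨x, hx⟩ := List.exists_duplicate_iff_not_nodup.mpr h
  induction hx with
  | cons_mem hm =>
    obtain ⟨s, t, rfl⟩ := List.append_of_mem hm
    exact ⟨[], x, s, t, rfl⟩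
  | @cons_duplicate y l hd ih =>
    obtain ⟨l₁, z, l₂, l₃, rfl⟩ := ih hd.not_nodup
    exact ⟨y :: l₁, z, l₂, l₃, rfl⟩

namespace MixedGraph

variable {W : Type*} (G : MixedGraph W)

theorem IsMConnecting.symm {Z : Set W} {u v : W} {l : List W}
    (h : G.IsMConnecting Z u v l) : G.IsMConnecting Z v u l.reverse := by
  have inf : ∀ a w b, [a, w, b] <:+: l.reverse → [b, w, a] <:+: l := by
    intro a w b hi
    simpa using List.reverse_infix.mpr hi
  refine ⟨⟨?_, ?_, ?_, List.nodup_reverse.mpr h.path.nodup⟩, ?_, ?_⟩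
  · rw [List.head?_reverse]; exact h.path.last
  · rw [List.getLast?_reverse]; exact h.path.head
  · rw [List.isChain_reverse]
    exact h.path.chain.imp fun a b hab => G.adj_symm hab
  · exact fun a w b hi hc => h.noncollider b w a (inf a w b hi) fun hc' => hc hc'.symm
  · exact fun a w b hi hc => h.collider b w a (inf a w b hi) hc.symm

theorem mSep_comm {Z : Set W} {u v : W} : G.MSep u v Z ↔ G.MSep v u Z :=
  ⟨fun h ⟨_, hl⟩ => h ⟨_, hl.symm⟩, fun h ⟨_, hl⟩ => h ⟨_, hl.symm⟩⟩

end MixedGraph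

/-! ### Active walks in a DAG; ancestry tests by intervention -/

namespace CausalDAG

variable {W : Type*} (D : CausalDAG W)

theorem adj_iff {x y : W} : D.toMixed.Adj x y ↔ D.edge x y ∨ D.edge y x := by
  simp [MixedGraph.Adj, toMixed]

theorem collider_iff {a w b : W} : D.toMixed.Collider a w b ↔ D.edge a w ∧ D.edge b w := by
  simp [MixedGraph.Collider, MixedGraph.Into, toMixed]

/-- A path that leaves its first node by a directed edge is directed or reaches a collider that
is a proper descendant of the first node. -/
theorem transGen_last_or_exists_collider {x b : W} {l : List W}
    (hl : (x :: b :: l).IsChain D.toMixed.Adj) (hx : D.edge x b) :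
    (∀ y, (x :: b :: l).getLast? = some y → Relation.TransGen D.edge x y) ∨
      ∃ p w q, [p, w, q] <:+: x :: b :: l ∧ D.toMixed.Collider p w q ∧
        Relation.TransGen D.edge x w := by
  induction l generalizing x b with
  | nil =>
    left
    intro y hy
    simp only [List.getLast?_cons_cons, List.getLast?_singleton, Option.some.injEq] at hy
    exact hy ▸ .single hx
  | cons c l ih =>
    rw [List.isChain_cons_cons] at hl
    rcases D.adj_iff.mp (List.isChain_cons_cons.mp hl.2).1 with hbc | hcb
    · rcases ih hl.2 hbc with h | ⟨p, w, q, hi, hc, ht⟩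
      · left
        intro y hy
        rw [List.getLast?_cons_cons] at hy
        exact .head hx (h y hy)
      · exact Or.inr ⟨p, w, q, List.infix_cons hi, hc, .head hx ht⟩
    · exact Or.inr ⟨x, b, c, ⟨[], l, rfl⟩, D.collider_iff.mpr ⟨hx, hcb⟩, .single hx⟩

/-- A walk all of whose colliders lie in `A` and all of whose interior non-colliders lie in `S`. -/
structure IsActiveWalk (S A : Set W) (u v : W) (l : List W) : Prop where
  head : l.head? = some u
  last : l.getLast? = some v
  chain : l.IsChain D.toMixed.Adj
  collider : ∀ a w b, [a, w, b] <:+: l → D.toMixed.Collider a w b → w ∈ A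
  noncollider : ∀ a w b, [a, w, b] <:+: l → ¬ D.toMixed.Collider a w b → w ∈ S

variable {D} {S A : Set W} {u v x : W}

/-- Only the triple `p, x, q` at the cut is new. Suppose it is a collider. If the loop starts with
an edge into `x`, then `x` was already a collider. Otherwise the loop leaves `x` along a directed
edge and, by acyclicity, meets a collider below `x`, so closure of `A` gives `x ∈ A`. If `x ∉ S`,
both old occurrences of `x` were colliders, hence both outer edges point to `x` and the new triple
is a collider. -/
theorem IsActiveWalk.of_remove_loop {l₁ l₂ l₃ : List W}
    (hA : ∀ x y, Relation.TransGen D.edge x y → y ∈ A → x ∈ A)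
    (h : D.IsActiveWalk S A u v (l₁ ++ x :: (l₂ ++ x :: l₃))) :
    D.IsActiveWalk S A u v (l₁ ++ x :: l₃) := by
  have i1 : l₁ ++ [x] <:+: l₁ ++ x :: (l₂ ++ x :: l₃) := ⟨[], l₂ ++ x :: l₃, by simp⟩
  have i2 : x :: l₃ <:+: l₁ ++ x :: (l₂ ++ x :: l₃) := ⟨l₁ ++ x :: l₂, [], by simp⟩
  have i3 : x :: (l₂ ++ [x]) <:+: l₁ ++ x :: (l₂ ++ x :: l₃) := ⟨l₁, l₃, by simp⟩
  have c3 := h.chain.infix i3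
  have key : ∀ s p q t, l₁ = s ++ [p] → l₃ = q :: t →
      (D.toMixed.Collider p x q → x ∈ A) ∧ (¬ D.toMixed.Collider p x q → x ∈ S) := by
    rintro s p q t rfl rfl
    obtain ⟨b, r, hb⟩ : ∃ b r, l₂ ++ [x] = b :: r :=
      List.exists_cons_of_ne_nil (by simp)
    obtain ⟨r', c, hc⟩ : ∃ r' c, x :: l₂ = r' ++ [c] :=
      ⟨_, _, (List.dropLast_append_getLast (List.cons_ne_nil x l₂)).symm⟩
    have t1 : [p, x, b] <:+: (s ++ [p]) ++ x :: (l₂ ++ x :: q :: t) :=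
      ⟨s, r ++ q :: t, by
        have : l₂ ++ x :: q :: t = (l₂ ++ [x]) ++ q :: t := by simp
        rw [this, hb]; simp⟩
    have t2 : [c, x, q] <:+: (s ++ [p]) ++ x :: (l₂ ++ x :: q :: t) :=
      ⟨(s ++ [p]) ++ r', t, by
        have : x :: (l₂ ++ x :: q :: t) = (x :: l₂) ++ x :: q :: t := by simp
        rw [this, hc]; simp⟩
    constructor
    · intro hpq
      rw [D.collider_iff] at hpq
      by_cases hbx : D.edge b x
      · exact h.collider p x b t1 (D.collider_iff.mpr ⟨hpq.1, hbx⟩)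
      · rw [hb] at c3
        have hxb := (D.adj_iff.mp (List.isChain_cons_cons.mp c3).1).resolve_right hbx
        rcases D.transGen_last_or_exists_collider c3 hxb with hl | ⟨p', w, q', hi, hcol, ht⟩
        · refine absurd (hl x ?_) (D.acyclic x)
          rw [← hb, ← List.cons_append, List.getLast?_concat]
        · refine hA _ _ ht (h.collider p' w q' ?_ hcol)
          rw [← hb] at hi
          exact hi.trans i3
    · intro hpq
      by_contra hxS
      have k1 := D.collider_iff.mp (by_contra fun hn => hxS (h.noncollider _ _ _ t1 hn))
      have k2 := D.collider_iff.mp (by_contra fun hn => hxS (h.noncollider _ _ _ t2 hn))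
      exact hpq (D.collider_iff.mpr ⟨k1.1, k2.2⟩)
  refine ⟨?_, ?_, ?_, ?_, ?_⟩
  · have := h.head
    cases l₁ <;> simpa using this
  · have := h.last
    simpa [List.getLast?_append, List.getLast?_cons] using this
  · exact List.isChain_split.mpr ⟨h.chain.infix i1, h.chain.infix i2⟩
  · intro a w b hi hc
    rcases List.triple_infix_append_cons hi with hi | hi | ⟨rfl, ⟨s, hs⟩, t, ht⟩
    · exact h.collider a w b (hi.trans i1) hc
    · exact h.collider a w b (hi.trans i2) hc
    · exact (key s a b t hs ht).1 hc
  · intro a w b hi hc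
    rcases List.triple_infix_append_cons hi with hi | hi | ⟨rfl, ⟨s, hs⟩, t, ht⟩
    · exact h.noncollider a w b (hi.trans i1) hc
    · exact h.noncollider a w b (hi.trans i2) hc
    · exact (key s a b t hs ht).2 hc

/-- Thanks to this, walks can be concatenated freely and turned into paths only at the end. -/
theorem IsActiveWalk.exists_nodup (hA : ∀ x y, Relation.TransGen D.edge x y → y ∈ A → x ∈ A)
    {l : List W} (h : D.IsActiveWalk S A u v l) :
    ∃ l', D.IsActiveWalk S A u v l' ∧ l'.Nodup := by
  induction hn : l.length using Nat.strong_induction_on generalizing l with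
  | _ n ih =>
    by_cases hd : l.Nodup
    · exact ⟨l, h, hd⟩
    · obtain ⟨l₁, x, l₂, l₃, rfl⟩ := List.exists_split_of_not_nodup hd
      exact ih _ (by rw [← hn]; simp) (h.of_remove_loop hA) rfl

/-- After mutilation a path from `u` must leave `u` by a directed edge. With nothing conditioned on,
colliders block, so a connecting path is directed throughout. Conversely, a directed walk from `u`
never re-enters `u`, by acyclicity, so it survives the mutilation. -/
theorem mutilate_mSep_empty_iff (D : CausalDAG W) {u v : W} (huv : u ≠ v) :
    (D.mutilate u).toMixed.MSep u v ∅ ↔ ¬ D.toMixed.Anc u v := by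
  refine not_congr ⟨?_, ?_⟩
  · rintro ⟨l, hl⟩
    match l, hl with
    | [], hl => simpa using hl.path.head
    | [a], hl =>
      have h1 := hl.path.head
      have h2 := hl.path.last
      simp only [List.head?_cons, List.getLast?_singleton, Option.some.injEq] at h1 h2
      exact absurd (h1.symm.trans h2) huv
    | a :: b :: l, hl =>
      have h1 : a = u := by simpa using hl.path.head
      subst h1
      have hab : (D.mutilate a).edge a b := by
        rcases (D.mutilate a).adj_iff.mp (List.isChain_cons_cons.mp hl.path.chain).1 with h | h
        · exact h
        · exact absurd rfl h.2
      rcases (D.mutilate a).transGen_last_or_exists_collider hl.path.chain hab with h | h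
      · exact (Relation.TransGen.mono (fun _ _ h => h.1) _ _ (h v hl.path.last)).to_reflTransGen
      · obtain ⟨p, w, q, hi, hc, -⟩ := h
        obtain ⟨z, hz, -⟩ := hl.collider p w q hi hc
        exact absurd hz (Set.notMem_empty z)
  · intro h
    have h' : Relation.ReflTransGen (D.mutilate u).edge u v := by
      clear huv
      induction h with
      | refl => exact .refl
      | @tail b c hb hbc ih =>
        refine ih.tail ⟨hbc, ?_⟩
        rintro rfl
        exact D.acyclic _ (Relation.TransGen.tail' hb hbc)
    obtain ⟨l, hl, hlast⟩ := List.exists_isChain_cons_of_relationReflTransGen h'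
    refine ⟨u :: l, ⟨rfl, ?_, ?_, ?_⟩, fun _ _ _ _ _ => Set.notMem_empty _, ?_⟩
    · rw [List.getLast?_eq_some_getLast (List.cons_ne_nil u l), hlast]
    · exact hl.imp fun a b h => (D.mutilate u).adj_iff.mpr (Or.inl h)
    -- Along a directed walk every node is a proper ancestor of all later ones, so acyclicity
    -- excludes repetitions.
    · have hp : (u :: l).Pairwise (Relation.TransGen (D.mutilate u).edge) :=
        (hl.imp fun _ _ h => Relation.TransGen.single h).pairwise
      refine hp.imp ?_
      rintro a _ h rfl
      exact (D.mutilate u).acyclic _ h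
    · intro a w b hi hc
      have := hl.infix hi
      simp only [List.isChain_cons_cons] at this
      exact ((D.mutilate u).toMixed.dir_asymm _ _ this.2.1
        ((D.mutilate u).collider_iff.mp hc).2).elim

/-! ### The MAG of a DAG is ancestral and maximal -/

variable {V L : Type*} {D : CausalDAG (V ⊕ L)}

/-- The nodes that are ancestors of `u` or `v`. -/
def ancestorsOfPair (D : CausalDAG W) (u v : W) : Set W :=
  {x | D.toMixed.Anc x u ∨ D.toMixed.Anc x v}

theorem ancestorsOfPair_closed (D : CausalDAG W) (u v : W) :
    ∀ x y, Relation.TransGen D.edge x y → y ∈ D.ancestorsOfPair u v →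
      x ∈ D.ancestorsOfPair u v :=
  fun _ _ h hy => hy.imp h.to_reflTransGen.trans h.to_reflTransGen.trans

/-- An inducing path is an active walk without repetitions, for `S` the latent nodes and `A` the
ancestors of the endpoints. This `A` is closed under ancestors, so loops can be cut. -/
theorem magAdj_iff_exists_activeWalk {u v : V} (huv : u ≠ v) :
    D.MagAdj u v ↔ ∃ l, D.IsActiveWalk (Set.range Sum.inr)
      (D.ancestorsOfPair (Sum.inl u) (Sum.inl v)) (Sum.inl u) (Sum.inl v) l := by
  constructor
  · rintro ⟨-, l, hl⟩
    exact ⟨l, hl.path.head, hl.path.last, hl.path.chain, hl.anc, fun a w b hi hc =>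
      by_contra fun hw => hc (hl.collider a w b hi hw)⟩
  · rintro ⟨l, hl⟩
    obtain ⟨l', hl', hd⟩ := hl.exists_nodup (D.ancestorsOfPair_closed _ _)
    exact ⟨huv, l', ⟨hl'.head, hl'.last, hl'.chain, hd⟩,
      fun a w b hi hw => by_contra fun hc => hw (hl'.noncollider a w b hi hc), hl'.collider⟩

theorem mag_anc {u v : V} (h : D.mag.Anc u v) : D.toMixed.Anc (Sum.inl u) (Sum.inl v) := by
  induction h with
  | refl => exact .refl
  | tail _ h ih => exact ih.trans h.2

theorem mag_adj_iff {u v : V} : D.mag.Adj u v ↔ D.MagAdj u v := by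
  constructor
  · rintro (h | h | h)
    · exact h.1
    · exact h.1.symm
    · exact h.1
  · intro h
    by_cases h1 : D.toMixed.Anc (Sum.inl u) (Sum.inl v)
    · exact Or.inl ⟨h, h1⟩
    by_cases h2 : D.toMixed.Anc (Sum.inl v) (Sum.inl u)
    · exact Or.inr (Or.inl ⟨h.symm, h2⟩)
    · exact Or.inr (Or.inr ⟨h, h1, h2⟩)

theorem not_anc_of_mag_into {u v : V} (h : D.mag.Into u v) :
    ¬ D.toMixed.Anc (Sum.inl v) (Sum.inl u) := by
  rcases h with h | h
  · exact fun h' => h.1.1 (Sum.inl_injective (D.anc_antisymm h.2 h'))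
  · exact h.2.2

/-- An inducing path leaves an endpoint that carries an arrowhead in the MAG by an edge that
points to this endpoint. -/
theorem edge_of_mag_into {x y : V} (h : D.mag.Into y x) {b : V ⊕ L} {l : List (V ⊕ L)}
    (hl : D.IsActiveWalk (Set.range Sum.inr) (D.ancestorsOfPair (Sum.inl x) (Sum.inl y))
      (Sum.inl x) (Sum.inl y) (Sum.inl x :: b :: l)) : D.edge b (Sum.inl x) := by
  have hn := not_anc_of_mag_into h
  -- If the first edge left `x`, the walk would be directed to `y` or reach a collider below `x`.
  -- That collider is an ancestor of `x`, giving a cycle, or of `y`. So `x` would be an ancestor of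
  -- `y`, against the arrowhead at `x`.
  refine (D.adj_iff.mp (List.isChain_cons_cons.mp hl.chain).1).resolve_left fun hxb => ?_
  rcases D.transGen_last_or_exists_collider hl.chain hxb with ht | ⟨p, w, q, hi, hc, ht⟩
  · exact hn (ht _ hl.last).to_reflTransGen
  · rcases hl.collider p w q hi hc with h' | h'
    · exact D.acyclic _ (ht.trans_left h')
    · exact hn (ht.to_reflTransGen.trans h')

theorem IsActiveWalk.reverse {W : Type*} {D : CausalDAG W} {S A : Set W} {u v : W} {l : List W}
    (h : D.IsActiveWalk S A u v l) : D.IsActiveWalk S A v u l.reverse := by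
  have inf : ∀ a w b, [a, w, b] <:+: l.reverse → [b, w, a] <:+: l := by
    intro a w b hi
    simpa using List.reverse_infix.mpr hi
  refine ⟨?_, ?_, ?_, ?_, ?_⟩
  · rw [List.head?_reverse]; exact h.last
  · rw [List.getLast?_reverse]; exact h.head
  · rw [List.isChain_reverse]
    exact h.chain.imp fun a b hab => D.toMixed.adj_symm hab
  · exact fun a w b hi hc => h.collider b w a (inf a w b hi) hc.symm
  · exact fun a w b hi hc => h.noncollider b w a (inf a w b hi) fun hc' => hc hc'.symm

theorem IsActiveWalk.mono {W : Type*} {D : CausalDAG W} {S A A' : Set W} {u v : W} {l : List W}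
    (h : D.IsActiveWalk S A u v l) (hA : A ⊆ A') : D.IsActiveWalk S A' u v l :=
  ⟨h.head, h.last, h.chain, fun a w b hi hc => hA (h.collider a w b hi hc), h.noncollider⟩

theorem IsActiveWalk.exists_cons_cons {W : Type*} {D : CausalDAG W} {S A : Set W} {u v : W}
    {l : List W} (h : D.IsActiveWalk S A u v l) (huv : u ≠ v) : ∃ b r, l = u :: b :: r := by
  match l, h with
  | [], h => simpa using h.head
  | [a], h =>
    have h1 := h.head
    have h2 := h.last
    simp only [List.head?_cons, List.getLast?_singleton, Option.some.injEq] at h1 h2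
    exact absurd (h1.symm.trans h2) huv
  | a :: b :: l, h => exact ⟨b, l, by simpa using h.head⟩

/-- Two active walks that meet in a collider can be joined. -/
theorem IsActiveWalk.append {W : Type*} {D : CausalDAG W} {S A : Set W} {x y z b c : W}
    {l₁ l₂ : List W} (h₁ : D.IsActiveWalk S A x y (l₁ ++ [c, y]))
    (h₂ : D.IsActiveWalk S A y z (y :: b :: l₂))
    (hc : D.edge c y) (hb : D.edge b y) (hy : y ∈ A) :
    D.IsActiveWalk S A x z (l₁ ++ c :: y :: b :: l₂) := by
  have e : l₁ ++ c :: y :: b :: l₂ = (l₁ ++ [c]) ++ y :: b :: l₂ := by simp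
  have e1 : l₁ ++ [c, y] = (l₁ ++ [c]) ++ [y] := by simp
  have key : ∀ a w d, [a, w, d] <:+: l₁ ++ c :: y :: b :: l₂ →
      [a, w, d] <:+: l₁ ++ [c, y] ∨ [a, w, d] <:+: y :: b :: l₂ ∨ (a = c ∧ w = y ∧ d = b) := by
    intro a w d hi
    rw [e] at hi
    rcases List.triple_infix_append_cons hi with hi | hi | ⟨rfl, ⟨s, hs⟩, t, ht⟩
    · exact Or.inl (e1 ▸ hi)
    · exact Or.inr (Or.inl hi)
    · simp only [List.cons.injEq] at ht
      have := List.append_inj_right' hs rfl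
      simp only [List.cons.injEq, and_true] at this
      exact Or.inr (Or.inr ⟨this.symm, rfl, ht.1.symm⟩)
  refine ⟨?_, ?_, ?_, ?_, ?_⟩
  · have := h₁.head
    cases l₁ <;> simpa using this
  · have := h₂.last
    rw [e, List.getLast?_append, this]
    rfl
  · rw [e]
    exact List.isChain_split.mpr ⟨e1 ▸ h₁.chain, h₂.chain⟩
  · intro a w d hi hcol
    rcases key a w d hi with hi | hi | ⟨rfl, rfl, rfl⟩
    · exact h₁.collider a w d hi hcol
    · exact h₂.collider a w d hi hcol
    · exact hy
  · intro a w d hi hcol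
    rcases key a w d hi with hi | hi | ⟨rfl, rfl, rfl⟩
    · exact h₁.noncollider a w d hi hcol
    · exact h₂.noncollider a w d hi hcol
    · exact absurd (D.collider_iff.mpr ⟨hc, hb⟩) hcol

/-- Each MAG edge is expanded into an inducing path of the DAG. At an interior node, a collider of
the MAG path, both expansions arrive by arrows (`edge_of_mag_into`), so they join at a collider in
`A`. The clause on the first edge is what the induction needs for the next join. -/
theorem exists_activeWalk_of_mag_path {A : Set (V ⊕ L)} (x y v : V) (l : List V)
    (hA : ∀ a b, Relation.TransGen D.edge a b → b ∈ A → a ∈ A)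
    (hlast : (x :: y :: l).getLast? = some v) (hchain : (x :: y :: l).IsChain D.mag.Adj)
    (hcol : ∀ a w b, [a, w, b] <:+: x :: y :: l → D.mag.Collider a w b)
    (hmem : ∀ a ∈ x :: y :: l, Sum.inl a ∈ A) :
    ∃ b r, D.IsActiveWalk (Set.range Sum.inr) A (Sum.inl x) (Sum.inl v) (Sum.inl x :: b :: r) ∧
      (D.mag.Into y x → D.edge b (Sum.inl x)) := by
  induction l generalizing x y with
  | nil =>
    have hv : y = v := by simpa using hlast
    subst hv
    have hadj := mag_adj_iff.mp (List.isChain_cons_cons.mp hchain).1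
    obtain ⟨p, hp⟩ := (magAdj_iff_exists_activeWalk hadj.1).mp hadj
    obtain ⟨b, r, rfl⟩ := hp.exists_cons_cons (Sum.inl_injective.ne hadj.1)
    refine ⟨b, r, hp.mono ?_, fun hi => edge_of_mag_into hi hp⟩
    rintro a (ha | ha)
    · rcases Relation.reflTransGen_iff_eq_or_transGen.mp ha with h | h
      · exact h ▸ hmem x (by simp)
      · exact hA _ _ h (hmem x (by simp))
    · rcases Relation.reflTransGen_iff_eq_or_transGen.mp ha with h | h
      · exact h ▸ hmem y (by simp)
      · exact hA _ _ h (hmem y (by simp))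
  | cons z l ih =>
    obtain ⟨hxy, hchain'⟩ := List.isChain_cons_cons.mp hchain
    obtain ⟨b', r', hw, hb'⟩ := ih y z (by simpa using hlast) hchain'
      (fun a w b hi => hcol a w b (List.infix_cons hi)) (fun a ha =>
        hmem a (List.mem_cons_of_mem _ ha))
    have hc := hcol x y z ⟨[], l, rfl⟩
    have hadj := mag_adj_iff.mp hxy
    obtain ⟨p, hp⟩ := (magAdj_iff_exists_activeWalk hadj.1).mp hadj
    have hp' : D.IsActiveWalk (Set.range Sum.inr) A (Sum.inl x) (Sum.inl y) p := by
      refine hp.mono ?_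
      rintro a (ha | ha)
      · rcases Relation.reflTransGen_iff_eq_or_transGen.mp ha with h | h
        · exact h ▸ hmem x (by simp)
        · exact hA _ _ h (hmem x (by simp))
      · rcases Relation.reflTransGen_iff_eq_or_transGen.mp ha with h | h
        · exact h ▸ hmem y (by simp)
        · exact hA _ _ h (hmem y (by simp))
    have hpr := hp.reverse
    obtain ⟨c, q, hq⟩ := hpr.exists_cons_cons (Sum.inl_injective.ne hadj.1.symm)
    have hpe : p = q.reverse ++ [c, Sum.inl y] := by
      rw [← List.reverse_reverse p, hq]; simp
    rw [hq] at hpr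
    have hcy : D.edge c (Sum.inl y) :=
      edge_of_mag_into hc.1 (hpr.mono fun a ha => Or.symm ha)
    obtain ⟨b, r, hbr⟩ := hp.exists_cons_cons (Sum.inl_injective.ne hadj.1)
    have happ := (hpe ▸ hp').append hw hcy (hb' hc.2) (hmem y (by simp))
    -- The joined walk starts with the same edge as `p`, so the arrowhead statement for `p` carries
    -- over.
    obtain ⟨r'', hr''⟩ : ∃ r'', q.reverse ++ c :: Sum.inl y :: b' :: r' = Sum.inl x :: b :: r'' := by
      have : q.reverse ++ c :: Sum.inl y :: b' :: r' = p ++ b' :: r' := by rw [hpe]; simp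
      rw [this, hbr]
      exact ⟨r ++ b' :: r', by simp⟩
    rw [hr''] at happ
    exact ⟨b, r'', happ, fun hi => edge_of_mag_into hi (hbr ▸ hp)⟩

/-- MAG ancestry implies DAG ancestry, whence the graph is ancestral. On an inducing path relative
to `∅` all interior nodes are colliders, hence ancestors of the endpoints. Its expansion in the DAG
is therefore an active walk, which makes the endpoints adjacent. -/
theorem mag_isMAG (D : CausalDAG (V ⊕ L)) : D.mag.IsMAG := by
  refine ⟨⟨?_, ?_⟩, ?_⟩
  · exact fun u v h h' => not_anc_of_mag_into (Or.inl h) (mag_anc h')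
  · exact fun u v h => ⟨fun h' => h.2.1 (mag_anc h'), fun h' => h.2.2 (mag_anc h')⟩
  · rintro u v huv hadj ⟨l, hl⟩
    refine hadj (mag_adj_iff.mpr ((magAdj_iff_exists_activeWalk huv).mpr ?_))
    match l, hl with
    | [], hl => simpa using hl.path.head
    | [a], hl =>
      have h1 := hl.path.head
      have h2 := hl.path.last
      simp only [List.head?_cons, List.getLast?_singleton, Option.some.injEq] at h1 h2
      exact absurd (h1.symm.trans h2) huv
    | a :: b :: l, hl =>
      have h1 : a = u := by simpa using hl.path.head
      subst h1
      have hcol : ∀ p w q, [p, w, q] <:+: a :: b :: l → D.mag.Collider p w q :=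
        fun p w q hi => hl.collider p w q hi (Set.notMem_empty _)
      have hmem : ∀ w ∈ a :: b :: l, Sum.inl w ∈ D.ancestorsOfPair (Sum.inl a) (Sum.inl v) := by
        intro w hw
        obtain ⟨s, t, hst⟩ := List.append_of_mem hw
        rcases List.eq_nil_or_concat s with rfl | ⟨s, p, rfl⟩
        · simp only [List.nil_append, List.cons.injEq] at hst
          exact Or.inl (hst.1 ▸ .refl)
        rcases t with _ | ⟨q, t⟩
        · have := hl.path.last
          rw [hst, List.getLast?_concat, Option.some.injEq] at this
          exact Or.inr (this ▸ .refl)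
        · have hi : [p, w, q] <:+: a :: b :: l := ⟨s, t, by rw [hst]; simp⟩
          exact (hl.anc p w q hi (hcol p w q hi)).imp mag_anc mag_anc
      obtain ⟨c, r, h, -⟩ := exists_activeWalk_of_mag_path a b v l
        (D.ancestorsOfPair_closed _ _) hl.path.last hl.path.chain hcol hmem
      exact ⟨_, h⟩

end CausalDAG

/-! ### Comparing incidence sets; reading PAG marks -/

namespace MixedGraph

variable {W : Type*} {G H : MixedGraph W} {u v : W}

theorem mem_markovClass_self (hG : G.IsMAG) : G ∈ G.markovClass :=
  ⟨hG, fun _ _ _ _ _ _ => Iff.rfl⟩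

theorem Adj.ne (h : G.Adj u v) : u ≠ v := by
  rintro rfl
  rcases h with h | h | h
  · exact G.dir_asymm _ _ h h
  · exact G.dir_asymm _ _ h h
  · exact G.bi_irrefl _ h

theorem ext_of_dir_bi (h₁ : ∀ u v, G.dir u v ↔ H.dir u v) (h₂ : ∀ u v, G.bi u v ↔ H.bi u v) :
    G = H := by
  cases G
  cases H
  congr
  · funext u v
    exact propext (h₁ u v)
  · funext u v
    exact propext (h₂ u v)

theorem eq_of_incidence_eq (h : ∀ u, G.incidence u = H.incidence u) : G = H := by
  refine ext_of_dir_bi (fun u v => ?_) (fun u v => ?_)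
  · simpa [incidence] using Set.ext_iff.mp (h u) (v, .tail)
  · simpa [incidence] using Set.ext_iff.mp (h u) (v, .bidirected)

theorem eq_of_nodeDist_eq_zero [Finite W] (h : G.nodeDist H = 0) : G = H := by
  have h' := (Set.ncard_eq_zero (Set.toFinite _)).mp h
  exact eq_of_incidence_eq fun u => by_contra fun hu => (h' ▸ hu : u ∈ (∅ : Set W))

theorem dir_iff_adj_and_not : G.dir v u ↔ G.Adj u v ∧ ¬ G.dir u v ∧ ¬ G.bi u v :=
  ⟨fun h => ⟨Or.inr (Or.inl h), G.dir_asymm _ _ h,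
    fun h' => G.dir_not_bi _ _ h (G.bi_symm _ _ h')⟩,
    fun h => (h.1.resolve_left h.2.1).resolve_right h.2.2⟩

theorem not_bidirectedVsDirected_self : ¬ BidirectedVsDirected G G u v := by
  rintro (h | h)
  · exact G.dir_not_bi _ _ h.2 (G.bi_symm _ _ h.1)
  · exact G.dir_not_bi _ _ h.1 (G.bi_symm _ _ h.2)

/-- An edge at `u` has one of three types; when children and neighbours agree, only `↔` and `←` can
be interchanged. -/
theorem xor_bi_iff (hdir : ∀ v, G.dir u v ↔ H.dir u v) (hadj : ∀ v, G.Adj u v ↔ H.Adj u v) :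
    Xor (G.bi u v) (H.bi u v) ↔ BidirectedVsDirected G H u v := by
  have d1 := G.dir_not_bi u v
  have d2 := H.dir_not_bi u v
  have d3 := fun h h' => G.dir_not_bi v u h (G.bi_symm _ _ h')
  have d4 := fun h h' => H.dir_not_bi v u h (H.bi_symm _ _ h')
  have h1 := hdir v
  have h2 := hadj v
  unfold Adj at h2
  unfold Xor BidirectedVsDirected
  tauto

/-- Nodes with the same children and neighbours but different incidence sets have an edge that is
bidirected on one side and directed on the other. -/
theorem exists_bidirectedVsDirected (hdir : ∀ v, G.dir u v ↔ H.dir u v)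
    (hadj : ∀ v, G.Adj u v ↔ H.Adj u v) (h : G.incidence u ≠ H.incidence u) :
    ∃ v, BidirectedVsDirected G H u v := by
  by_contra hn
  push Not at hn
  have hbi : ∀ v, G.bi u v ↔ H.bi u v := by
    intro v
    have := mt (xor_bi_iff hdir hadj).mp (hn v)
    unfold Xor at this
    tauto
  have hin : ∀ v, G.dir v u ↔ H.dir v u := by
    intro v
    rw [dir_iff_adj_and_not (G := G), dir_iff_adj_and_not (G := H), hdir, hadj, hbi]
  refine h (Set.ext fun p => ?_)
  simp only [incidence, Set.mem_ofPred_eq, hdir, hin, hbi]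

theorem dir_of_pag_mark_eq_tail (h : G.pag.mark u v = .tail) (hH : H ∈ G.markovClass) :
    H.dir v u := by
  simp only [pag] at h
  split_ifs at h with h1 h2
  exact h2 H hH

theorem into_of_pag_mark_eq_arrow (h : G.pag.mark u v = .arrow) (hH : H ∈ G.markovClass) :
    H.Into u v := by
  simp only [pag] at h
  split_ifs at h with h1
  exact h1 H hH

theorem pag_mark_eq_arrow_of_tail (h : G.pag.mark u v = .tail) : G.pag.mark v u = .arrow := by
  have : ∀ H ∈ G.markovClass, H.Into v u :=
    fun H hH => Or.inl (dir_of_pag_mark_eq_tail h hH)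
  simp only [pag]
  rw [if_pos this]

variable (hG : G.IsMAG)
include hG

theorem dir_of_pag_directed (h : G.pag.Directed u v) : G.dir u v :=
  dir_of_pag_mark_eq_tail h.2.1 (mem_markovClass_self hG)

theorem bi_of_pag_bidirected (h : G.pag.Bidirected u v) : G.bi u v := by
  rcases into_of_pag_mark_eq_arrow h.2.1 (mem_markovClass_self hG) with h1 | h1
  · rcases into_of_pag_mark_eq_arrow h.2.2 (mem_markovClass_self hG) with h2 | h2
    · exact absurd h2 (G.dir_asymm _ _ h1)
    · exact h2
  · exact G.bi_symm _ _ h1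

/-- The mark at `u` is not an arrowhead, the mark at `v` is not a tail, and an invariant tail at `u`
forces an arrowhead at `v`. Exactly three combinations survive, all inspected by the algorithm. -/
theorem pag_of_dir (h : G.dir u v) :
    G.pag.Directed u v ∨ G.pag.CircleCircle u v ∨ G.pag.CircleArrow u v := by
  have hs := mem_markovClass_self hG
  have hadj : G.pag.adj u v := Or.inl h
  have h1 : G.pag.mark v u ≠ .arrow := by
    intro hm
    rcases into_of_pag_mark_eq_arrow hm hs with h' | h'
    · exact G.dir_asymm _ _ h h'
    · exact G.dir_not_bi _ _ h (G.bi_symm _ _ h')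
  have h2 : G.pag.mark u v ≠ .tail := fun hm =>
    G.dir_asymm _ _ h (dir_of_pag_mark_eq_tail hm hs)
  have h3 := pag_mark_eq_arrow_of_tail (G := G) (u := v) (v := u)
  unfold PAG.Directed PAG.CircleCircle PAG.CircleArrow
  cases e1 : G.pag.mark v u <;> cases e2 : G.pag.mark u v <;> simp_all

theorem pag_of_bi (h : G.bi u v) :
    G.pag.Bidirected u v ∨ G.pag.CircleCircle u v ∨ G.pag.CircleArrow v u ∨
      G.pag.CircleArrow u v := by
  have hs := mem_markovClass_self hG
  have hadj : G.pag.adj u v := Or.inr (Or.inr h)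
  have hadj' : G.pag.adj v u := Or.inr (Or.inr (G.bi_symm _ _ h))
  have h1 : G.pag.mark v u ≠ .tail := fun hm =>
    G.dir_not_bi _ _ (dir_of_pag_mark_eq_tail hm hs) h
  have h2 : G.pag.mark u v ≠ .tail := fun hm =>
    G.dir_not_bi _ _ (dir_of_pag_mark_eq_tail hm hs) (G.bi_symm _ _ h)
  unfold PAG.Bidirected PAG.CircleCircle PAG.CircleArrow
  cases e1 : G.pag.mark v u <;> cases e2 : G.pag.mark u v <;> simp_all

end MixedGraph

/-! ### What the tests reveal -/

namespace AlphaGeneral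

variable {V : Type*} [Fintype V]

theorem testIndep_observe {law : V → ProbabilityMeasure (V → ℝ)} {log : List V} {w u v : V} :
    TestIndep (observe law log) w u v ↔ w ∈ log ∧ CITest (law w) u v ∅ := by
  unfold TestIndep observe
  split_ifs with h <;> simp [h]

theorem testDep_observe {law : V → ProbabilityMeasure (V → ℝ)} {log : List V} {w u v : V} :
    TestDep (observe law log) w u v ↔ w ∈ log ∧ ¬ CITest (law w) u v ∅ := by
  unfold TestDep observe
  split_ifs with h <;> simp [h]

variable {E : Entity V} (hE : E.MarkovFaithful)
include hE

theorem ciTest_left_iff {u v : V} (huv : u ≠ v) :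
    CITest (E.doLaw u) u v ∅ ↔ ¬ E.dag.toMixed.Anc (Sum.inl u) (Sum.inl v) := by
  rw [hE u u v ∅ huv (Finset.notMem_empty _) (Finset.notMem_empty _), Finset.coe_empty,
    Set.image_empty, CausalDAG.mutilate_mSep_empty_iff _ (Sum.inl_injective.ne huv)]

theorem ciTest_right_iff {u v : V} (huv : u ≠ v) :
    CITest (E.doLaw v) u v ∅ ↔ ¬ E.dag.toMixed.Anc (Sum.inl v) (Sum.inl u) := by
  rw [hE v u v ∅ huv (Finset.notMem_empty _) (Finset.notMem_empty _), Finset.coe_empty,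
    Set.image_empty, MixedGraph.mSep_comm,
    CausalDAG.mutilate_mSep_empty_iff _ (Sum.inl_injective.ne huv.symm)]

/-- For an adjacent pair, dependence under `do(u)` says that `u` is an ancestor of `v`, which is the
orientation `u → v`. -/
theorem identifyOutNbr_eq {log : List V} {u : V} (hu : u ∈ log) :
    identifyOutNbr E.mag.pag (observe E.doLaw log) u = {v | E.mag.dir u v} := by
  have hG : E.mag.IsMAG := CausalDAG.mag_isMAG _
  ext v
  simp only [identifyOutNbr, Set.mem_union, Set.mem_ofPred_eq, testDep_observe, hu, true_and]
  constructor
  · rintro (h | ⟨h, ht⟩)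
    · exact MixedGraph.dir_of_pag_directed hG h
    · have hadj : E.mag.Adj u v := h.elim (fun h => h.1) fun h => h.1
      rw [ciTest_left_iff hE hadj.ne, not_not] at ht
      exact ⟨CausalDAG.mag_adj_iff.mp hadj, ht⟩
  · intro h
    rcases MixedGraph.pag_of_dir hG h with h' | h'
    · exact Or.inl h'
    · refine Or.inr ⟨h', ?_⟩
      rw [ciTest_left_iff hE h.1.1, not_not]
      exact h.2

theorem mem_identifyBidirected_iff {log : List V} {u v : V} (hu : u ∈ log) (hv : v ∈ log) :
    v ∈ identifyBidirected E.mag.pag (observe E.doLaw log) u ↔ E.mag.bi u v := by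
  have hG : E.mag.IsMAG := CausalDAG.mag_isMAG _
  simp only [identifyBidirected, Set.mem_union, Set.mem_ofPred_eq, testIndep_observe, hu, hv,
    true_and]
  constructor
  · rintro (h | ⟨h, ht⟩)
    · exact MixedGraph.bi_of_pag_bidirected hG h
    · have hadj : E.mag.Adj u v := by
        rcases h with h | h | h
        · exact h.1
        · exact E.mag.adj_symm h.1
        · exact h.1
      rw [ciTest_left_iff hE hadj.ne, ciTest_right_iff hE hadj.ne] at ht
      exact ⟨CausalDAG.mag_adj_iff.mp hadj, ht⟩
  · intro h
    rcases MixedGraph.pag_of_bi hG h with h' | h'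
    · exact Or.inl h'
    · refine Or.inr ⟨h', ?_⟩
      rw [ciTest_left_iff hE h.1.1, ciTest_right_iff hE h.1.1]
      exact h.2

end AlphaGeneral

/-! ### The effect of one round -/

namespace AlphaGeneral

variable {V : Type*} [Fintype V] {M s : ℕ} {E : Fin M → Entity V}
  (hE : ∀ i, (E i).MarkovFaithful)
include hE

theorem initialGraph_adj_iff {S : Fin s → V} {i j : Fin M} :
    (initialGraph (fun i => (E i).mag.pag) (fun i => (E i).doLaw) S).Adj i j ↔
      i ≠ j ∧ ∀ a, (∀ v, (E i).mag.dir (S a) v ↔ (E j).mag.dir (S a) v) ∧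
        ∀ v, (E i).mag.Adj (S a) v ↔ (E j).mag.Adj (S a) v := by
  have hmem : ∀ (k : Fin M) a, S a ∈ initialLog (M := M) S k := fun k a => by
    simp [initialLog]
  simp only [initialGraph]
  refine and_congr_right fun _ => forall_congr' fun a => ?_
  rw [identifyOutNbr_eq (hE i) (hmem i a), identifyOutNbr_eq (hE j) (hmem j a), Set.ext_iff,
    Set.ext_iff]
  exact Iff.rfl

theorem differ_iff {S : Fin s → V} {i j : Fin M} {a : Fin s} {v : V} {log : Fin M → List V}
    (hij : (initialGraph (fun i => (E i).mag.pag) (fun i => (E i).doLaw) S).Adj i j)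
    (hai : S a ∈ log i) (haj : S a ∈ log j) (hvi : v ∈ log i) (hvj : v ∈ log j) :
    Differ (fun i => (E i).mag.pag) (fun i => (E i).doLaw) log (S a) v i j ↔
      MixedGraph.BidirectedVsDirected (E i).mag (E j).mag (S a) v := by
  have h := ((initialGraph_adj_iff hE).mp hij).2 a
  rw [← MixedGraph.xor_bi_iff h.1 h.2, Differ, mem_identifyBidirected_iff (hE i) hai hvi,
    mem_identifyBidirected_iff (hE j) haj hvj]

theorem mem_candidates_iff {S : Fin s → V} {P : SimpleGraph (Fin M)} {log : Fin M → List V}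
    {π : Fin M → V} {x : Fin M × Fin M × V}
    (hP : P ≤ initialGraph (fun i => (E i).mag.pag) (fun i => (E i).doLaw) S)
    (hS : ∀ i a, S a ∈ log i) (hπ : ∀ i, π i ∈ log i) :
    x ∈ candidates (fun i => (E i).mag.pag) (fun i => (E i).doLaw) S P log π ↔
      P.Adj x.1 x.2.1 ∧ π x.1 = π x.2.1 ∧ ∃ a, S a = x.2.2 ∧
        MixedGraph.BidirectedVsDirected (E x.1).mag (E x.2.1).mag (S a) (π x.1) := by
  obtain ⟨i, j, u⟩ := x
  simp only [candidates, Finset.mem_filter, Finset.mem_univ, true_and, Set.mem_range]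
  refine and_congr_right fun hij => and_congr_right fun hπij => ?_
  constructor
  · rintro ⟨⟨a, rfl⟩, h⟩
    exact ⟨a, rfl, (differ_iff hE (hP hij) (hS i a) (hS j a) (hπ i) (hπij ▸ hπ j)).mp h⟩
  · rintro ⟨a, rfl, h⟩
    exact ⟨⟨a, rfl⟩, (differ_iff hE (hP hij) (hS i a) (hS j a) (hπ i) (hπij ▸ hπ j)).mpr h⟩

theorem refine_spec {pick : Finset (Fin M × Fin M × V) → Fin M × Fin M × V}
    (hpick : ∀ s : Finset (Fin M × Fin M × V), s.Nonempty → pick s ∈ s)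
    {S : Fin s → V} {P : SimpleGraph (Fin M)} {log : Fin M → List V} (π : Fin M → V)
    (hP : P ≤ initialGraph (fun i => (E i).mag.pag) (fun i => (E i).doLaw) S)
    (hS : ∀ i a, S a ∈ log i) :
    ((refine (fun i => (E i).mag.pag) (fun i => (E i).doLaw) pick S P log π).1 = P ∧
      ¬ ∃ i j a, P.Adj i j ∧ π i = π j ∧
        MixedGraph.BidirectedVsDirected (E i).mag (E j).mag (S a) (π i)) ∨
    ∃ i₀ j₀ a, P.Adj i₀ j₀ ∧ π i₀ = π j₀ ∧
      MixedGraph.BidirectedVsDirected (E i₀).mag (E j₀).mag (S a) (π i₀) ∧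
      ∀ i j, (refine (fun i => (E i).mag.pag) (fun i => (E i).doLaw) pick S P log π).1.Adj i j ↔
        P.Adj i j ∧ ¬ (P.Reachable i₀ i ∧
          MixedGraph.BidirectedVsDirected (E i).mag (E j).mag (S a) (π i₀)) := by
  have hS' : ∀ i a, S a ∈ (fun i => π i :: log i) i := fun i a => List.mem_cons_of_mem _ (hS i a)
  have hmem := fun x => mem_candidates_iff hE (x := x) hP hS' (π := π)
    fun i => List.mem_cons_self
  unfold refine
  dsimp only
  split_ifs with hc
  · right
    have hp := (hmem _).mp (hpick _ hc)
    generalize pick (candidates _ _ S P _ π) = x at hp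
    obtain ⟨i₀, j₀, u⟩ := x
    dsimp only at hp
    obtain ⟨hij, hπ, a, rfl, hb⟩ := hp
    refine ⟨i₀, j₀, a, hij, hπ, hb, fun i j => ?_⟩
    simp only [removeEdges]
    refine and_congr_right fun hadj => not_congr ?_
    rw [← and_assoc]
    -- The ends of an edge lie in the same component, so the second reachability condition is
    -- redundant.
    have hr : P.Reachable i₀ i ∧ P.Reachable i₀ j ↔ P.Reachable i₀ i :=
      and_iff_left_of_imp fun h => h.trans hadj.reachable
    rw [hr]
    refine and_congr_right fun hi => ?_
    have hj := hi.trans hadj.reachable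
    -- The whole component has been intervened on at the selected node, so the comparison is exact
    -- for `i` and `j`.
    apply differ_iff hE (hP hadj)
    · simp [hi, hS i a]
    · simp [hj, hS j a]
    · simp [hi]
    · simp [hj]
  · left
    refine ⟨rfl, ?_⟩
    rintro ⟨i, j, a, hij, hπ, hb⟩
    exact hc ⟨(i, j, S a), (hmem _).mpr ⟨hij, hπ, a, rfl, hb⟩⟩

end AlphaGeneral

/-! ### Probability estimates -/

namespace PMF

open scoped ENNReal

theorem toOuterMeasure_apply_le_one {α : Type*} (p : PMF α) (s : Set α) :
    p.toOuterMeasure s ≤ 1 := by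
  rw [toOuterMeasure_apply, ← p.tsum_coe]
  exact ENNReal.tsum_le_tsum fun a => Set.indicator_le_self _ _ a

theorem one_sub_le_toOuterMeasure_of_compl_le {α : Type*} (p : PMF α) (s : Set α) {c : ℝ≥0∞}
    (h : p.toOuterMeasure sᶜ ≤ c) : 1 - c ≤ p.toOuterMeasure s := by
  rw [tsub_le_iff_right]
  refine le_trans ?_ (add_le_add_right h _)
  rw [toOuterMeasure_apply, toOuterMeasure_apply, ← ENNReal.tsum_add, ← p.tsum_coe]
  refine ENNReal.tsum_le_tsum fun a => ?_
  rw [← Pi.add_apply, Set.indicator_self_add_compl]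

/-- A bad first draw is counted as a full failure; all other draws contribute at most `c` on
average. -/
theorem toOuterMeasure_bind_le {α β : Type*} (p : PMF α) (f : α → PMF β) (s : Set β) (F : Set α)
    {c : ℝ≥0∞} (h : ∀ a ∉ F, (f a).toOuterMeasure s ≤ c) :
    (p.bind f).toOuterMeasure s ≤ p.toOuterMeasure F + c := by
  have h1 : ∀ a, p a * (f a).toOuterMeasure s ≤ F.indicator p a + p a * c := by
    intro a
    by_cases ha : a ∈ F
    · rw [Set.indicator_of_mem ha]
      refine le_add_right ?_
      exact mul_le_of_le_one_right' (toOuterMeasure_apply_le_one _ _)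
    · rw [Set.indicator_of_notMem ha, zero_add]
      gcongr
      exact h a ha
  rw [toOuterMeasure_bind_apply, toOuterMeasure_apply]
  refine (ENNReal.tsum_le_tsum h1).trans ?_
  rw [ENNReal.tsum_add, ENNReal.tsum_mul_right, p.tsum_coe, one_mul]

/-- The probability that independent uniform samples with indices in `A` all miss `B`. -/
theorem toOuterMeasure_uniform_forall_notMem_le {ι V : Type*} [Fintype ι] [DecidableEq ι]
    [Fintype V] [Nonempty V] (A : Finset ι) (B : Finset V) :
    (uniformOfFintype (ι → V)).toOuterMeasure {f | ∀ i ∈ A, f i ∉ B} ≤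
      ENNReal.ofReal (Real.exp (-((A.card : ℝ) * B.card / Fintype.card V))) := by
  classical
  have hn : 0 < (Fintype.card V : ℝ) := by exact_mod_cast Fintype.card_pos
  rw [toOuterMeasure_uniformOfFintype_apply]
  have hcard : Fintype.card {f : ι → V | ∀ i ∈ A, f i ∉ B} =
      ∏ i, (if i ∈ A then Bᶜ else Finset.univ : Finset V).card := by
    rw [← Fintype.card_piFinset, Fintype.card_ofFinset]
    congr 1
    ext f
    simp only [Finset.mem_filter, Finset.mem_univ, true_and, Fintype.mem_piFinset,
      Set.mem_ofPred_eq]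
    refine forall_congr' fun i => ?_
    split_ifs with h <;> simp [h]
  have hle : (Fintype.card {f : ι → V | ∀ i ∈ A, f i ∉ B} : ℝ) ≤
      Real.exp (-((A.card : ℝ) * B.card / Fintype.card V)) * Fintype.card (ι → V) := by
    rw [hcard, Nat.cast_prod]
    calc ∏ i, ((if i ∈ A then Bᶜ else Finset.univ : Finset V).card : ℝ)
        ≤ ∏ i, ((if i ∈ A then Real.exp (-(B.card / Fintype.card V : ℝ)) else 1) *
            (Fintype.card V : ℝ)) := by
          refine Finset.prod_le_prod (fun _ _ => by positivity) fun i _ => ?_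
          split_ifs
          · rw [Finset.card_compl, Nat.cast_sub (Finset.card_le_univ B)]
            -- Each coordinate in `A` avoids `B` in a fraction `1 - |B| / |V| ≤ exp (-|B| / |V|)` of
            -- cases.
            have := Real.add_one_le_exp (-(B.card / Fintype.card V : ℝ))
            calc (Fintype.card V : ℝ) - B.card
                = (-(B.card / Fintype.card V : ℝ) + 1) * Fintype.card V := by field_simp; ring
              _ ≤ _ := by gcongr
          · simp
      _ = _ := by
          rw [Finset.prod_mul_distrib, Finset.prod_const, Finset.prod_ite, Finset.prod_const_one,
            mul_one, Finset.prod_const, ← Real.exp_nat_mul, Finset.filter_univ_mem,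
            Fintype.card_fun, Nat.cast_pow, Finset.card_univ]
          congr 2
          ring
  have hpos : 0 < (Fintype.card (ι → V) : ℝ) := by exact_mod_cast Fintype.card_pos
  rw [← ENNReal.ofReal_natCast, ← ENNReal.ofReal_natCast, ← ENNReal.ofReal_div_of_pos hpos]
  exact ENNReal.ofReal_le_ofReal ((div_le_iff₀ hpos).mpr hle)

end PMF

/-! ### Clusters -/

section Clusters

variable {V : Type*} [Fintype V] {M : ℕ} {G : Fin M → MixedGraph V} {α : ℝ}
  {C : Finpartition (Finset.univ : Finset (Fin M))}

theorem MixedGraph.nodeDist_self {W : Type*} (H : MixedGraph W) : H.nodeDist H = 0 := by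
  simp [MixedGraph.nodeDist]

theorem IsAlphaClustering.eq_of_mem (h : IsAlphaClustering G α C) {A : Finset (Fin M)}
    (hA : A ∈ C.parts) {i j : Fin M} (hi : i ∈ A) (hj : j ∈ A) : G i = G j := by
  have := h.2.2.1 A hA i hi j hj
  rw [zero_mul] at this
  exact MixedGraph.eq_of_nodeDist_eq_zero (by exact_mod_cast le_antisymm this (by positivity))

theorem IsAlphaClustering.part_eq_part [Nonempty V] (h : IsAlphaClustering G α C)
    {A B : Finset (Fin M)} (hA : A ∈ C.parts) (hB : B ∈ C.parts) {i j : Fin M} (hi : i ∈ A)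
    (hj : j ∈ B) (hij : G i = G j) : A = B := by
  by_contra hAB
  have := h.2.2.2 A hA B hB hAB i hi j hj
  rw [hij, MixedGraph.nodeDist_self, Nat.cast_zero] at this
  have h1 : 0 < α := h.2.1
  have h2 : 0 < (Fintype.card V : ℝ) := by exact_mod_cast Fintype.card_pos
  exact absurd this (not_le.mpr (mul_pos h1 h2))

theorem IsAlphaClustering.mem_iff [Nonempty V] (h : IsAlphaClustering G α C)
    {A : Finset (Fin M)} (hA : A ∈ C.parts) {i j : Fin M} (hi : i ∈ A) :
    j ∈ A ↔ G j = G i := by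
  refine ⟨fun hj => h.eq_of_mem hA hj hi, fun hj => ?_⟩
  obtain ⟨B, hB, hjB⟩ := C.exists_mem (Finset.mem_univ j)
  exact h.part_eq_part hB hA hjB hi hj ▸ hjB

theorem IsAlphaClustering.le_nodeDist [Nonempty V] (h : IsAlphaClustering G α C) {i j : Fin M}
    (hij : G i ≠ G j) : α * (Fintype.card V : ℝ) ≤ ((G i).nodeDist (G j) : ℝ) := by
  obtain ⟨A, hA, hiA⟩ := C.exists_mem (Finset.mem_univ i)
  obtain ⟨B, hB, hjB⟩ := C.exists_mem (Finset.mem_univ j)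
  refine h.2.2.2 A hA B hB ?_ i hiA j hjB
  rintro rfl
  exact hij (h.eq_of_mem hA hiA hjB)

theorem IsAlphaClustering.ncard_range_le (h : IsAlphaClustering G α C) :
    (Set.range G).ncard ≤ C.parts.card := by
  classical
  have hf : ∀ i : Fin M, ∃ A ∈ C.parts, i ∈ A := fun i => C.exists_mem (Finset.mem_univ i)
  choose f hf hfi using hf
  rw [← Set.ncard_coe_finset C.parts]
  -- A MAG goes to the cluster of a chosen entity carrying it; this is injective because a cluster
  -- carries a single MAG. The value `∅` is never used.
  refine Set.ncard_le_ncard_of_injOn (fun g => if hg : g ∈ Set.range G then f hg.choose else ∅)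
    ?_ ?_ (Finset.finite_toSet _)
  · intro g hg
    simp only [hg, dif_pos]
    exact hf _
  · intro g hg g' hg' he
    simp only [hg, hg', dif_pos] at he
    rw [← hg.choose_spec, ← hg'.choose_spec]
    exact h.eq_of_mem (hf _) (hfi _) (he ▸ hfi _)

end Clusters

/-! ### Invariants of a run and the number of interventions -/

namespace AlphaGeneral

variable {V : Type*} [Fintype V] {M s : ℕ} {E : Fin M → Entity V} {S : Fin s → V}
  {P : SimpleGraph (Fin M)} {log : Fin M → List V}
  {pick : Finset (Fin M × Fin M × V) → Fin M × Fin M × V}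

/-- The states that a run with sample `S` can reach: the graph on the entities is a subgraph of the
initial graph, joins all entities with equal MAGs, and depends only on the MAGs. -/
structure IsState (E : Fin M → Entity V) (S : Fin s → V) (P : SimpleGraph (Fin M))
    (log : Fin M → List V) : Prop where
  le_initialGraph : P ≤ initialGraph (fun i => (E i).mag.pag) (fun i => (E i).doLaw) S
  mem_log : ∀ i a, S a ∈ log i
  adj_of_eq : ∀ i j, i ≠ j → (E i).mag = (E j).mag → P.Adj i j
  adj_congr : ∀ i j i' j', P.Adj i j → (E i).mag = (E i').mag → (E j).mag = (E j').mag →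
    i' ≠ j' → P.Adj i' j'

/-- The pairs of MAGs of joined entities. -/
def joinedPairs (E : Fin M → Entity V) (P : SimpleGraph (Fin M)) :
    Set (MixedGraph V × MixedGraph V) :=
  {p | ∃ i j, P.Adj i j ∧ p = ((E i).mag, (E j).mag)}

omit [Fintype V] in
theorem joinedPairs_subset (E : Fin M → Entity V) (P : SimpleGraph (Fin M)) :
    joinedPairs E P ⊆ Set.range (fun i => (E i).mag) ×ˢ Set.range (fun i => (E i).mag) := by
  rintro _ ⟨i, j, -, rfl⟩
  exact ⟨⟨i, rfl⟩, ⟨j, rfl⟩⟩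

omit [Fintype V] in
theorem finite_joinedPairs (E : Fin M → Entity V) (P : SimpleGraph (Fin M)) :
    (joinedPairs E P).Finite :=
  ((Set.finite_range _).prod (Set.finite_range _)).subset (joinedPairs_subset E P)

theorem ncard_joinedPairs_le {α : ℝ} {C : Finpartition (Finset.univ : Finset (Fin M))}
    (hC : IsAlphaClustering (fun i => (E i).mag) α C) (P : SimpleGraph (Fin M)) :
    (joinedPairs E P).ncard ≤ C.parts.card ^ 2 := by
  refine (Set.ncard_le_ncard (joinedPairs_subset E P)
    ((Set.finite_range _).prod (Set.finite_range _))).trans ?_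
  rw [Set.ncard_prod, sq]
  exact Nat.mul_le_mul hC.ncard_range_le hC.ncard_range_le

theorem length_refine_le (U : Fin M → PAG V) (law : Fin M → V → ProbabilityMeasure (V → ℝ))
    (π : Fin M → V) (i : Fin M) :
    ((refine U law pick S P log π).2 i).length ≤ (log i).length + 2 := by
  unfold refine
  dsimp only
  split_ifs
  · dsimp only
    split_ifs <;> simp
  · simp

theorem subset_refine_log (U : Fin M → PAG V) (law : Fin M → V → ProbabilityMeasure (V → ℝ))
    (π : Fin M → V) (i : Fin M) : log i ⊆ (refine U law pick S P log π).2 i := by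
  intro v hv
  unfold refine
  dsimp only
  split_ifs
  · dsimp only
    split_ifs <;> simp [hv]
  · simp [hv]

section

variable (hE : ∀ i, (E i).MarkovFaithful)
include hE

theorem isState_initial (S : Fin s → V) :
    IsState E S (initialGraph (fun i => (E i).mag.pag) (fun i => (E i).doLaw) S)
      (initialLog S) := by
  refine ⟨le_rfl, fun i a => by simp [initialLog], fun i j hij h => ?_,
    fun i j i' j' h hi hj hij => ?_⟩
  · rw [initialGraph_adj_iff hE, h]
    exact ⟨hij, fun a => ⟨fun v => Iff.rfl, fun v => Iff.rfl⟩⟩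
  · rw [initialGraph_adj_iff hE] at h ⊢
    rw [← hi, ← hj]
    exact ⟨hij, h.2⟩

variable (hpick : ∀ s : Finset (Fin M × Fin M × V), s.Nonempty → pick s ∈ s)
  (hP : IsState E S P log) (π : Fin M → V)
include hpick hP

/-- Entities with equal MAGs are joined, so a component is a union of classes of equal MAGs. Whether
an edge is removed thus depends only on the two MAGs, and a MAG never differs from itself. -/
theorem IsState.refine :
    IsState E S (refine (fun i => (E i).mag.pag) (fun i => (E i).doLaw) pick S P log π).1
      (AlphaGeneral.refine (fun i => (E i).mag.pag) (fun i => (E i).doLaw) pick S P log π).2 := by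
  refine ⟨(refine_le _ _ _ _ _ _ _).trans hP.le_initialGraph,
    fun i a => subset_refine_log _ _ _ _ (hP.mem_log i a), ?_, ?_⟩
  · intro i j hij h
    rcases refine_spec hE hpick π hP.le_initialGraph hP.mem_log with h' | ⟨i₀, j₀, a, -, -, -, h'⟩
    · rw [h'.1]
      exact hP.adj_of_eq i j hij h
    · rw [h', h]
      exact ⟨hP.adj_of_eq i j hij h, fun hn => MixedGraph.not_bidirectedVsDirected_self hn.2⟩
  · intro i j i' j' hadj hi hj hij
    rcases refine_spec hE hpick π hP.le_initialGraph hP.mem_log with h' | ⟨i₀, j₀, a, -, -, -, h'⟩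
    · rw [h'.1] at hadj ⊢
      exact hP.adj_congr i j i' j' hadj hi hj hij
    · rw [h'] at hadj ⊢
      refine ⟨hP.adj_congr i j i' j' hadj.1 hi hj hij, fun hn => hadj.2 ⟨?_, ?_⟩⟩
      · by_cases hii : i' = i
        · exact hii ▸ hn.1
        · exact hn.1.trans (hP.adj_of_eq i' i hii hi.symm).reachable
      · rw [hi, hj]
        exact hn.2

/-- The selected pair of MAGs disappears completely: one surviving edge between these two classes
would, by `adj_congr`, keep the selected edge too. Hence productive rounds are counted by pairs of
MAGs instead of pairs of entities. -/
theorem joinedPairs_refine_ssubset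
    (hne : (AlphaGeneral.refine (fun i => (E i).mag.pag) (fun i => (E i).doLaw) pick S P log π).1
      ≠ P) :
    joinedPairs E
      (AlphaGeneral.refine (fun i => (E i).mag.pag) (fun i => (E i).doLaw) pick S P log π).1 ⊂
      joinedPairs E P := by
  have hst := hP.refine hE hpick π
  rcases refine_spec hE hpick π hP.le_initialGraph hP.mem_log with
    h' | ⟨i₀, j₀, a, h₀, -, hb, h'⟩
  · exact absurd h'.1 hne
  · refine (Set.ssubset_iff_of_subset ?_).mpr ⟨((E i₀).mag, (E j₀).mag), ⟨i₀, j₀, h₀, rfl⟩, ?_⟩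
    · rintro _ ⟨i, j, hij, rfl⟩
      exact ⟨i, j, refine_le _ _ _ _ _ _ _ hij, rfl⟩
    · rintro ⟨i, j, hij, he⟩
      rw [Prod.mk.injEq] at he
      have := hst.adj_congr i j i₀ j₀ hij he.1.symm he.2.symm h₀.ne
      rw [h'] at this
      exact this.2 ⟨.refl _, hb⟩

-- Every productive round costs at most two and lowers the number of joined pairs; the final `2`
-- pays for the round that stops.
omit π in
theorem length_log_le_of_mem_support_loop [Nonempty V] {r : Result V M}
    (hr : r ∈ (loop (fun i => (E i).mag.pag) (fun i => (E i).doLaw) pick S P log).support)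
    (i : Fin M) : (r.log i).length ≤ (log i).length + 2 * (joinedPairs E P).ncard + 2 := by
  induction hn : (joinedPairs E P).ncard using Nat.strong_induction_on generalizing P log with
  | _ n ih =>
    rw [loop, PMF.mem_support_bind_iff] at hr
    obtain ⟨π, -, hr⟩ := hr
    have hlen := length_refine_le (pick := pick) (S := S) (P := P) (log := log)
      (fun i => (E i).mag.pag) (fun i => (E i).doLaw) π i
    split_ifs at hr with h
    · rw [PMF.mem_support_pure_iff] at hr
      subst hr
      dsimp only
      omega
    · have hlt := Set.ncard_lt_ncard (joinedPairs_refine_ssubset hE hpick hP π h)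
        (finite_joinedPairs E P)
      have := ih _ (hn ▸ hlt) (hP.refine hE hpick π) hr rfl
      omega

omit hE hpick in
/-- A state that joins only entities with equal MAGs has the true clusters as components. -/
theorem IsState.components_eq [Nonempty V] {α : ℝ}
    {C : Finpartition (Finset.univ : Finset (Fin M))}
    (hC : IsAlphaClustering (fun i => (E i).mag) α C)
    (h : ∀ i j, P.Adj i j → (E i).mag = (E j).mag) :
    components P = (fun A : Finset (Fin M) => (A : Set (Fin M))) '' (C.parts : Set _) := by
  have hr : ∀ i j, P.Reachable i j ↔ (E i).mag = (E j).mag := by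
    intro i j
    constructor
    · rintro ⟨p⟩
      induction p with
      | nil => rfl
      | cons hadj _ ih => exact (h _ _ hadj).trans ih
    · intro hij
      by_cases he : i = j
      · exact he ▸ .refl _
      · exact (hP.adj_of_eq i j he hij).reachable
  have hs : ∀ A ∈ C.parts, ∀ i ∈ A, (P.connectedComponentMk i).supp = (A : Set (Fin M)) := by
    intro A hA i hi
    ext j
    rw [SimpleGraph.ConnectedComponent.mem_supp_iff, SimpleGraph.ConnectedComponent.eq, hr,
      Finset.mem_coe, hC.mem_iff hA hi]
  ext T
  constructor
  · rintro ⟨c, rfl⟩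
    induction c using SimpleGraph.ConnectedComponent.ind with
    | _ i =>
      obtain ⟨A, hA, hi⟩ := C.exists_mem (Finset.mem_univ i)
      exact ⟨A, hA, (hs A hA i hi).symm⟩
  · rintro ⟨A, hA, rfl⟩
    obtain ⟨i, hi⟩ := C.nonempty_of_mem_parts hA
    exact ⟨_, hs A hA i hi⟩

end

end AlphaGeneral

/-! ### Failure probability of a run -/

namespace AlphaGeneral

open scoped ENNReal

variable {V : Type*} [Fintype V] [Nonempty V] {M s : ℕ} {E : Fin M → Entity V} {S : Fin s → V}
  {P : SimpleGraph (Fin M)} {log : Fin M → List V}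
  {pick : Finset (Fin M × Fin M × V) → Fin M × Fin M × V} {α : ℝ}
  {C : Finpartition (Finset.univ : Finset (Fin M))}

/-- While an edge joins different MAGs, a revealing node `v` is fixed before `π` is drawn, and the
round fails to progress with probability at most `ε`. Progress removes an edge, so `ε` is paid at
most once per edge. Without such edges, stopping is always correct. -/
theorem toOuterMeasure_loop_compl_le (hE : ∀ i, (E i).MarkovFaithful)
    (hpick : ∀ s : Finset (Fin M × Fin M × V), s.Nonempty → pick s ∈ s)
    (hC : IsAlphaClustering (fun i => (E i).mag) α C)
    (hS : ∀ i j, (E i).mag ≠ (E j).mag →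
      ∃ a, (E i).mag.incidence (S a) ≠ (E j).mag.incidence (S a))
    {ε : ℝ≥0∞}
    (hε : ∀ i j v, (PMF.uniformOfFintype (Fin M → V)).toOuterMeasure
      {π | ¬ ∃ i' j', (E i').mag = (E i).mag ∧ (E j').mag = (E j).mag ∧ π i' = v ∧ π j' = v} ≤ ε)
    (hP : IsState E S P log) :
    (loop (fun i => (E i).mag.pag) (fun i => (E i).doLaw) pick S P log).toOuterMeasure
      {r | r.clusters = (fun A : Finset (Fin M) => (A : Set (Fin M))) '' (C.parts : Set _)}ᶜ ≤
      P.edgeSet.ncard * ε := by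
  induction hn : P.edgeSet.ncard using Nat.strong_induction_on generalizing P log with
  | _ n ih =>
    have hlt : ∀ π, (refine (fun i => (E i).mag.pag) (fun i => (E i).doLaw) pick S P log π).1 ≠ P →
        (refine (fun i => (E i).mag.pag) (fun i => (E i).doLaw) pick S P log π).1.edgeSet.ncard
          < n := fun π h => hn ▸ Set.ncard_lt_ncard (SimpleGraph.edgeSet_ssubset_edgeSet.mpr
            (lt_of_le_of_ne (refine_le _ _ _ _ _ _ _) h))
    rw [loop]
    by_cases hcross : ∃ i j, P.Adj i j ∧ (E i).mag ≠ (E j).mag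
    · obtain ⟨i, j, hij, hne⟩ := hcross
      obtain ⟨a, ha⟩ := hS i j hne
      have hinit := (initialGraph_adj_iff hE).mp (hP.le_initialGraph hij)
      obtain ⟨v, hv⟩ := MixedGraph.exists_bidirectedVsDirected (hinit.2 a).1 (hinit.2 a).2 ha
      have hpos : 0 < n := by
        rw [← hn, Set.ncard_pos]
        exact ⟨s(i, j), hij⟩
      obtain ⟨m, rfl⟩ : ∃ m, n = m + 1 := ⟨n - 1, by omega⟩
      refine (PMF.toOuterMeasure_bind_le _ _ _ {π | ¬ ∃ i' j', (E i').mag = (E i).mag ∧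
        (E j').mag = (E j).mag ∧ π i' = v ∧ π j' = v} (c := (m : ℝ≥0∞) * ε) ?_).trans ?_
      · intro π hπ
        rw [Set.mem_ofPred_eq, not_not] at hπ
        obtain ⟨i', j', hi', hj', hvi, hvj⟩ := hπ
        have hne' : i' ≠ j' := by
          rintro rfl
          exact hne (hi'.symm.trans hj')
        -- The entities `i` and `j` need not draw `v` themselves: any representatives of their MAGs
        -- are joined too.
        have hadj := hP.adj_congr i j i' j' hij hi'.symm hj'.symm hne'
        have hchange : (refine (fun i => (E i).mag.pag) (fun i => (E i).doLaw) pick S P log π).1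
            ≠ P := by
          intro he
          rcases refine_spec hE hpick π hP.le_initialGraph hP.mem_log with
            h | ⟨i₀, j₀, b, h₀, -, hb, h⟩
          · refine h.2 ⟨i', j', a, hadj, hvi.trans hvj.symm, ?_⟩
            rw [hi', hj', hvi]
            exact hv
          · rw [he] at h
            exact ((h i₀ j₀).mp h₀).2 ⟨.refl _, hb⟩
        rw [dif_neg hchange]
        refine (ih _ (hlt π hchange) (hP.refine hE hpick π) rfl).trans ?_
        gcongr
        exact Nat.le_of_lt_succ (hlt π hchange)
      · refine (add_le_add_left (hε i j v) _).trans (le_of_eq ?_)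
        push_cast
        ring
    · push Not at hcross
      refine (PMF.toOuterMeasure_bind_le _ _ _ ∅ (c := (n : ℝ≥0∞) * ε) ?_).trans ?_
      · intro π _
        split_ifs with h
        · rw [PMF.toOuterMeasure_pure_apply, if_neg]
          · exact zero_le
          · rw [Set.mem_compl_iff, not_not, h]
            exact hP.components_eq hC hcross
        · refine (ih _ (hlt π h) (hP.refine hE hpick π) rfl).trans ?_
          gcongr
          exact (hlt π h).le
      · simp

/-- In every two clusters, some entities are assigned a given node, up to the stated probability. -/
theorem toOuterMeasure_uniform_not_hit_le (hC : IsAlphaClustering (fun i => (E i).mag) α C)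
    {t : ℝ} (ht : ∀ A ∈ C.parts, t * (Fintype.card V : ℝ) ≤ (A.card : ℝ)) (i j : Fin M) (v : V) :
    (PMF.uniformOfFintype (Fin M → V)).toOuterMeasure
      {π | ¬ ∃ i' j', (E i').mag = (E i).mag ∧ (E j').mag = (E j).mag ∧ π i' = v ∧ π j' = v} ≤
      ENNReal.ofReal (2 * Real.exp (-t)) := by
  have hn : 0 < (Fintype.card V : ℝ) := by exact_mod_cast Fintype.card_pos
  obtain ⟨A, hA, hiA⟩ := C.exists_mem (Finset.mem_univ i)
  obtain ⟨B, hB, hjB⟩ := C.exists_mem (Finset.mem_univ j)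
  have hmiss : ∀ T ∈ C.parts, (PMF.uniformOfFintype (Fin M → V)).toOuterMeasure
      {π | ∀ k ∈ T, π k ∉ ({v} : Finset V)} ≤ ENNReal.ofReal (Real.exp (-t)) := by
    intro T hT
    refine (PMF.toOuterMeasure_uniform_forall_notMem_le T {v}).trans
      (ENNReal.ofReal_le_ofReal (Real.exp_le_exp.mpr (neg_le_neg ?_)))
    rw [Finset.card_singleton, Nat.cast_one, mul_one, le_div_iff₀ hn]
    exact ht T hT
  calc _ ≤ (PMF.uniformOfFintype (Fin M → V)).toOuterMeasure
        ({π | ∀ k ∈ A, π k ∉ ({v} : Finset V)} ∪ {π | ∀ k ∈ B, π k ∉ ({v} : Finset V)}) := by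
        refine measure_mono fun π hπ => ?_
        by_contra hc
        simp only [Set.mem_union, Set.mem_ofPred_eq, Finset.mem_singleton] at hc
        push Not at hc
        obtain ⟨⟨i', hi', hvi⟩, j', hj', hvj⟩ := hc
        exact hπ ⟨i', j', (hC.mem_iff hA hiA).mp hi', (hC.mem_iff hB hjB).mp hj', hvi, hvj⟩
    _ ≤ _ := measure_union_le _ _
    _ ≤ ENNReal.ofReal (Real.exp (-t)) + ENNReal.ofReal (Real.exp (-t)) :=
        add_le_add (hmiss A hA) (hmiss B hB)
    _ = _ := by
        rw [← ENNReal.ofReal_add (Real.exp_pos _).le (Real.exp_pos _).le, two_mul]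

/-- A uniform sample misses the nodes at which two different MAGs differ with small probability. -/
theorem toOuterMeasure_uniform_not_separate_le (hC : IsAlphaClustering (fun i => (E i).mag) α C)
    (s : ℕ) : (PMF.uniformOfFintype (Fin s → V)).toOuterMeasure
      {S | ¬ ∀ i j, (E i).mag ≠ (E j).mag →
        ∃ a, (E i).mag.incidence (S a) ≠ (E j).mag.incidence (S a)} ≤
      ENNReal.ofReal ((M : ℝ) ^ 2 * Real.exp (-(s * α))) := by
  classical
  have hn : 0 < (Fintype.card V : ℝ) := by exact_mod_cast Fintype.card_pos
  have hpair : ∀ p : Fin M × Fin M, (PMF.uniformOfFintype (Fin s → V)).toOuterMeasure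
      {S | (E p.1).mag ≠ (E p.2).mag ∧
        ∀ a, (E p.1).mag.incidence (S a) = (E p.2).mag.incidence (S a)} ≤
      ENNReal.ofReal (Real.exp (-(s * α))) := by
    rintro ⟨i, j⟩
    dsimp only
    by_cases hij : (E i).mag = (E j).mag
    · simp [hij]
    -- By clustering, `B` fills at least a fraction `α` of the nodes, and an inseparable sample
    -- misses it entirely.
    · let B : Finset V := {u | (E i).mag.incidence u ≠ (E j).mag.incidence u}
      have hB : α * (Fintype.card V : ℝ) ≤ (B.card : ℝ) := by
        have hcard : B.card = (E i).mag.nodeDist (E j).mag := by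
          rw [MixedGraph.nodeDist, ← Set.ncard_coe_finset]
          simp [B]
        rw [hcard]
        exact hC.le_nodeDist hij
      refine le_trans (measure_mono ?_) ((PMF.toOuterMeasure_uniform_forall_notMem_le
        Finset.univ B).trans (ENNReal.ofReal_le_ofReal (Real.exp_le_exp.mpr (neg_le_neg ?_))))
      · intro S hS a _
        simp [B, hS.2 a]
      · rw [Finset.card_univ, Fintype.card_fin, mul_div_assoc]
        gcongr
        rwa [le_div_iff₀ hn]
  calc _ ≤ (PMF.uniformOfFintype (Fin s → V)).toOuterMeasure
        (⋃ p ∈ (Finset.univ : Finset (Fin M × Fin M)), {S | (E p.1).mag ≠ (E p.2).mag ∧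
          ∀ a, (E p.1).mag.incidence (S a) = (E p.2).mag.incidence (S a)}) := by
        refine measure_mono fun S hS => ?_
        simp only [Set.mem_ofPred_eq] at hS
        push Not at hS
        obtain ⟨i, j, hij, ha⟩ := hS
        simp only [Finset.mem_univ, Set.iUnion_true, Set.mem_iUnion]
        exact ⟨(i, j), hij, ha⟩
    _ ≤ ∑ _p : Fin M × Fin M, ENNReal.ofReal (Real.exp (-(s * α))) :=
        (measure_biUnion_finset_le _ _).trans (Finset.sum_le_sum fun p _ => hpair p)
    _ = _ := by
        rw [Finset.sum_const, Finset.card_univ, Fintype.card_prod, Fintype.card_fin, nsmul_eq_mul,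
          ENNReal.ofReal_mul (by positivity)]
        congr 1
        rw [ENNReal.ofReal_pow (by positivity), ENNReal.ofReal_natCast]
        push_cast
        ring

theorem toOuterMeasure_run_compl_le (hE : ∀ i, (E i).MarkovFaithful)
    (hpick : ∀ s : Finset (Fin M × Fin M × V), s.Nonempty → pick s ∈ s)
    (hC : IsAlphaClustering (fun i => (E i).mag) α C) {t δ : ℝ}
    (ht : ∀ A ∈ C.parts, t * (Fintype.card V : ℝ) ≤ (A.card : ℝ)) :
    (run (fun i => (E i).mag.pag) (fun i => (E i).doLaw) pick α δ).toOuterMeasure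
      {r | r.clusters = (fun A : Finset (Fin M) => (A : Set (Fin M))) '' (C.parts : Set _)}ᶜ ≤
      ENNReal.ofReal ((M : ℝ) ^ 2 * (Real.exp (-(sampleSize M α δ * α)) + 2 * Real.exp (-t))) := by
  rw [run, mul_add, ENNReal.ofReal_add (by positivity) (by positivity)]
  refine (PMF.toOuterMeasure_bind_le _ _ _ _ fun S hS => ?_).trans
    (add_le_add_left (toOuterMeasure_uniform_not_separate_le hC _) _)
  rw [Set.mem_ofPred_eq, not_not] at hS
  refine (toOuterMeasure_loop_compl_le hE hpick hC hS
    (toOuterMeasure_uniform_not_hit_le hC ht) (isState_initial hE S)).trans ?_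
  rw [ENNReal.ofReal_mul (p := (M : ℝ) ^ 2) (by positivity), ← Nat.cast_pow,
    ENNReal.ofReal_natCast]
  gcongr
  classical
  rw [← SimpleGraph.coe_edgeFinset, Set.ncard_coe_finset]
  refine SimpleGraph.card_edgeFinset_le_card_choose_two.trans ?_
  rw [Fintype.card_fin]
  exact Nat.choose_le_pow M 2

theorem length_log_le_of_mem_support_run (hE : ∀ i, (E i).MarkovFaithful)
    (hpick : ∀ s : Finset (Fin M × Fin M × V), s.Nonempty → pick s ∈ s)
    (hC : IsAlphaClustering (fun i => (E i).mag) α C) {δ : ℝ} {r : Result V M}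
    (hr : r ∈ (run (fun i => (E i).mag.pag) (fun i => (E i).doLaw) pick α δ).support)
    (i : Fin M) : (r.log i).length ≤ sampleSize M α δ + 2 * C.parts.card ^ 2 + 2 := by
  rw [run, PMF.mem_support_bind_iff] at hr
  obtain ⟨S, -, hr⟩ := hr
  have h1 := length_log_le_of_mem_support_loop hE hpick (isState_initial hE S) hr i
  have h2 := ncard_joinedPairs_le hC
    (initialGraph (fun i => (E i).mag.pag) (fun i => (E i).doLaw) S)
  have h3 : (initialLog (M := M) S i).length = sampleSize M α δ := by simp [initialLog]
  omega

end AlphaGeneral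

/-- The failure probabilities of sampling and refinement add up to at most `δ`. -/
theorem failure_probability_le {M s : ℕ} {α δ : ℝ} (hM : 1 ≤ M) (hδ : 0 < δ) (hδ' : δ < 1)
    (hx : δ / M ≤ 1 / 2) (hs : 2 * Real.log (2 * M / δ) ≤ s * α) :
    (M : ℝ) ^ 2 * (Real.exp (-(s * α)) + 2 * Real.exp (-(4 * Real.log (M / δ)))) ≤ δ := by
  have hM' : (0 : ℝ) < M := by exact_mod_cast hM
  have e1 : Real.exp (-(s * α)) ≤ (δ / (2 * M)) ^ 2 := by
    calc Real.exp (-(s * α)) ≤ Real.exp (-(2 * Real.log (2 * M / δ))) := by gcongr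
      _ = (δ / (2 * M)) ^ 2 := by
        rw [← mul_neg, ← Real.log_inv, inv_div, mul_comm, Real.exp_mul,
          Real.exp_log (by positivity)]
        norm_cast
  have e2 : Real.exp (-(4 * Real.log (M / δ))) = (δ / M) ^ 4 := by
    rw [← mul_neg, ← Real.log_inv, inv_div, mul_comm, Real.exp_mul, Real.exp_log (by positivity)]
    norm_cast
  -- Sampling contributes at most `δ ^ 2 / 4`; refinement contributes `2 * δ ^ 2 * (δ / M) ^ 2 ≤ δ ^
  -- 2 / 2`. The sum is below `δ`.
  have h3 : (M : ℝ) ^ 2 * (δ / (2 * M)) ^ 2 = δ ^ 2 / 4 := by field_simp; norm_num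
  have h4 : (M : ℝ) ^ 2 * (2 * (δ / M) ^ 4) = 2 * δ ^ 2 * (δ / M) ^ 2 := by field_simp
  have h5 : (δ / M) ^ 2 ≤ (1 / 2) ^ 2 := by gcongr
  rw [e2, mul_add, h4]
  have h6 := mul_le_mul_of_nonneg_left e1 (sq_nonneg (M : ℝ))
  rw [h3] at h6
  nlinarith [mul_le_mul_of_nonneg_left h5 (sq_nonneg δ), mul_lt_mul_of_pos_left hδ' hδ]

theorem mainTheorem5 :
    ∃ c K : ℝ, 0 < c ∧ 0 < K ∧
      ∀ (V : Type) [Fintype V] [Nonempty V] (M : ℕ) (E : Fin M → Entity V) (α δ : ℝ)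
        (C : Finpartition (Finset.univ : Finset (Fin M)))
        (pick : Finset (Fin M × Fin M × V) → Fin M × Fin M × V),
        (∀ i, (E i).MarkovFaithful) →
        (∀ s : Finset (Fin M × Fin M × V), s.Nonempty → pick s ∈ s) →
        0 < δ → δ < 1 → (2 ≤ M ∨ δ ≤ 1 / 2) →
        IsAlphaClustering (fun i => (E i).mag) α C →
        (∀ A ∈ C.parts,
          c * (Fintype.card V : ℝ) * Real.log ((M : ℝ) / δ) ≤ (A.card : ℝ)) →
        -- exact recovery of the clusters with probability at least `1 - δ`
        (ENNReal.ofReal (1 - δ) ≤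
          (AlphaGeneral.run (fun i => (E i).mag.pag) (fun i => (E i).doLaw) pick α
            δ).toOuterMeasure
            {r | r.clusters = (fun A : Finset (Fin M) => (A : Set (Fin M))) '' (C.parts : Set _)}) ∧
        -- the number of atomic interventions in every entity, for every outcome of the coins
        (∀ r ∈ (AlphaGeneral.run (fun i => (E i).mag.pag) (fun i => (E i).doLaw) pick α
            δ).support, ∀ i : Fin M,
          ((r.log i).length : ℝ) ≤
            K * (Real.log ((M : ℝ) / δ) / α + (C.parts.card : ℝ) ^ 2)) ∧
        -- what one refinement round does
        (∀ (s : ℕ) (S : Fin s → V) (P : SimpleGraph (Fin M)) (log : Fin M → List V)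
          (π : Fin M → V),
          P ≤ AlphaGeneral.initialGraph (fun i => (E i).mag.pag) (fun i => (E i).doLaw) S →
          (∀ i a, S a ∈ log i) →
          ((AlphaGeneral.refine (fun i => (E i).mag.pag) (fun i => (E i).doLaw)
              pick S P log π).1 = P ∧
            ¬ ∃ i j a, P.Adj i j ∧ π i = π j ∧
              MixedGraph.BidirectedVsDirected (E i).mag (E j).mag (S a) (π i)) ∨
          ∃ i₀ j₀ a, P.Adj i₀ j₀ ∧ π i₀ = π j₀ ∧
            MixedGraph.BidirectedVsDirected (E i₀).mag (E j₀).mag (S a) (π i₀) ∧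
            ∀ i j, (AlphaGeneral.refine (fun i => (E i).mag.pag) (fun i => (E i).doLaw)
                pick S P log π).1.Adj i j ↔
              P.Adj i j ∧ ¬ (P.Reachable i₀ i ∧
                MixedGraph.BidirectedVsDirected (E i).mag (E j).mag (S a) (π i₀))) := by
  -- The factor `4` makes a round miss with probability at most `2 * (δ / M) ^ 4`. For `5`: the
  -- sample costs at most `4 * log (M / δ) / α + 1`, the loop `2 * k ^ 2 + 2`, and the constant `3`
  -- is absorbed by `3 * k ^ 2`.
  refine ⟨4, 5, by norm_num, by norm_num, ?_⟩
  intro V _ _ M E α δ C pick hE hpick hδ hδ' hMδ hC hsize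
  have hα : 0 < α := hC.2.1
  -- This is where `M ≥ 2` or `δ ≤ 1 / 2` enters: it gives `2 ≤ M / δ`, so `log (2 * M / δ)` is at
  -- most twice `log (M / δ)`.
  have hhalf : 1 ≤ M → δ / M ≤ 1 / 2 := by
    intro hM
    have hM' : (0 : ℝ) < M := by exact_mod_cast hM
    rw [div_le_iff₀ hM']
    rcases hMδ with h | h
    · have : (2 : ℝ) ≤ M := by exact_mod_cast h
      linarith
    · have : (1 : ℝ) ≤ M := by exact_mod_cast hM
      linarith
  have hsample : 2 * Real.log (2 * M / δ) ≤ AlphaGeneral.sampleSize M α δ * α :=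
    (div_le_iff₀ hα).mp (Nat.le_ceil _)
  refine ⟨?_, ?_, ?_⟩
  · rw [ENNReal.ofReal_sub _ hδ.le, ENNReal.ofReal_one]
    refine PMF.one_sub_le_toOuterMeasure_of_compl_le _ _ ?_
    refine (AlphaGeneral.toOuterMeasure_run_compl_le hE hpick hC
      (t := 4 * Real.log (M / δ)) fun A hA => ?_).trans (ENNReal.ofReal_le_ofReal ?_)
    · rw [mul_right_comm]
      exact hsize A hA
    · rcases Nat.eq_zero_or_pos M with rfl | hM
      · simpa using hδ.le
      · exact failure_probability_le hM hδ hδ' (hhalf hM) hsample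
  · intro r hr i
    have hM : 1 ≤ M := i.pos
    have hM' : (0 : ℝ) < M := by exact_mod_cast hM
    have hlen : ((r.log i).length : ℝ) ≤
        AlphaGeneral.sampleSize M α δ + 2 * (C.parts.card : ℝ) ^ 2 + 2 := by
      exact_mod_cast AlphaGeneral.length_log_le_of_mem_support_run hE hpick hC hr i
    have hk : (1 : ℝ) ≤ (C.parts.card : ℝ) ^ 2 := by
      obtain ⟨A, hA, -⟩ := C.exists_mem (Finset.mem_univ i)
      exact_mod_cast Nat.one_le_pow _ _ (Finset.card_pos.mpr ⟨A, hA⟩)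
    have hx : (2 : ℝ) ≤ M / δ := by
      have := hhalf hM
      rw [div_le_iff₀ hM'] at this
      rw [le_div_iff₀ hδ]
      linarith
    have hlog : Real.log (2 * M / δ) ≤ 2 * Real.log (M / δ) := by
      rw [mul_div_assoc, Real.log_mul (by norm_num) (by positivity), two_mul]
      gcongr
    have hl0 : 0 ≤ Real.log (M / δ) := Real.log_nonneg (by linarith)
    have hl1 : 0 ≤ Real.log (2 * M / δ) := by
      rw [mul_div_assoc]
      exact Real.log_nonneg (by linarith)
    have hs : (AlphaGeneral.sampleSize M α δ : ℝ) ≤ 4 * (Real.log (M / δ) / α) + 1 := by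
      refine (Nat.ceil_lt_add_one (by positivity)).le.trans ?_
      rw [← mul_div_assoc]
      gcongr ?_ / α + 1
      linarith
    have : 0 ≤ Real.log (M / δ) / α := by positivity
    linarith
  · intro s S P log π hP hS
    exact AlphaGeneral.refine_spec hE hpick π hP hS
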